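/- Graphs are finite and may have loops and parallel edges. A circuit is a connected 2-regular subgraph. A circuit double cover of a graph $G$ is a multiset of circuits of $G$ such that every edge of $G$ lies in exactly two of its members (counted with multiplicity); $\nu(G)$ denotes the number of circuit double covers of $G$. A graph is cyclically $4$-edge-connected if every edge cut both of whose sides contain a circuit has at least $4$ edges. Let $G$ be a cyclically $4$-edge-connected cubic graph other than $K_4$ (equivalently, with $|V(G)| \neq 4$), and let $v_0v_1v_2v_3$ be a 4-cycle in $G$ with edges $e_i = v_iv_{i+1}$ (indices modulo $4$). Let $G_1$ be the graph obtained from $G - \{e_0, e_2\}$, and $G_2$ the graph obtained from $G - \{e_1, e_3\}$, by suppressing all vertices of degree $2$. Then $$\nu(G) \ge 4 \min\{\nu(G_1), \nu(G_2)\}.$$ -/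

import Mathlib

/-!
Finite multigraphs (loops and parallel edges allowed) are Mathlib's `Graph α β`; `H ≤ G` is the
subgraph order.
-/

namespace Graph

/-- The degree of a vertex, a loop being counted twice. -/
noncomputable def deg {α β : Type*} (G : Graph α β) (x : α) : ℕ∞ :=
  (G.incidenceSet x).encard + (G.loopSet x).encard

/-- Every vertex has degree three. -/
def IsCubic {α β : Type*} (G : Graph α β) : Prop :=
  ∀ x ∈ G.vertexSet, G.deg x = 3

/-- `G` has a vertex, and any two vertices are joined by a walk. -/
def IsConnected {α β : Type*} (G : Graph α β) : Prop :=
  G.vertexSet.Nonempty ∧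
    ∀ x ∈ G.vertexSet, ∀ y ∈ G.vertexSet, Relation.ReflTransGen G.Adj x y

/-- A circuit: a finite connected 2-regular graph, i.e. a cycle `C_k` with `k ≥ 1`. -/
def IsCircuit {α β : Type*} (C : Graph α β) : Prop :=
  C.vertexSet.Finite ∧ C.IsConnected ∧ ∀ x ∈ C.vertexSet, C.deg x = 2

open Classical in
/-- A circuit double cover of `G`: a multiset of circuits of `G` such that every edge of `G`
lies in exactly two members, counted with multiplicity. -/
def IsCircuitDoubleCover {α β : Type*} (G : Graph α β) (𝒞 : Multiset (Graph α β)) : Prop :=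
  (∀ C ∈ 𝒞, C ≤ G ∧ C.IsCircuit) ∧
    ∀ e ∈ G.edgeSet, 𝒞.countP (fun C => e ∈ C.edgeSet) = 2

/-- The number of circuit double covers of `G` (a natural number whenever `G` is finite). -/
noncomputable def nu {α β : Type*} (G : Graph α β) : ℕ∞ :=
  {𝒞 : Multiset (Graph α β) | G.IsCircuitDoubleCover 𝒞}.encard

/-- The edge cut between a set `X` of vertices and its complement. -/
def edgeCut {α β : Type*} (G : Graph α β) (X : Set α) : Set β :=
  {e | ∃ x ∈ X, ∃ y ∈ G.vertexSet \ X, G.IsLink e x y}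

/-- Every edge cut that has a circuit on each of its two sides has at least `k` edges. -/
def IsCyclicallyEdgeConnected {α β : Type*} (G : Graph α β) (k : ℕ) : Prop :=
  ∀ X ⊆ G.vertexSet,
    (∃ C : Graph α β, C ≤ G.induce X ∧ C.IsCircuit) →
    (∃ C : Graph α β, C ≤ G.induce (G.vertexSet \ X) ∧ C.IsCircuit) →
    (k : ℕ∞) ≤ (G.edgeCut X).encard

/-- `H'` arises from `H` by suppressing one vertex `v` of degree two that lies on two different
edges `e = vx` and `f = vy`: the vertex `v` and both edges are removed and a new edge joining
`x` and `y` is added (a loop if `x = y`). The new edge reuses the label `e`. -/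
def SuppressStep {α β : Type*} (H H' : Graph α β) : Prop :=
  ∃ (v x y : α) (e f : β), H.deg v = 2 ∧ e ≠ f ∧ H.IsLink e v x ∧ H.IsLink f v y ∧
    H'.vertexSet = H.vertexSet \ {v} ∧
    ∀ (g : β) (a b : α), H'.IsLink g a b ↔
      (g = e ∧ ((a = x ∧ b = y) ∨ (a = y ∧ b = x))) ∨ (g ≠ e ∧ g ≠ f ∧ H.IsLink g a b)

/-- `H'` arises from `H` by suppressing vertices of degree two, one after another, until there
are none left. -/
def IsSuppressionOf {α β : Type*} (H' H : Graph α β) : Prop :=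
  Relation.ReflTransGen SuppressStep H H' ∧ ∀ v ∈ H'.vertexSet, H'.deg v ≠ 2

/-- The vertices `v 0, v 1, v 2, v 3` are different and, in this cyclic order, joined by the
edges `e 0, e 1, e 2, e 3` of `G`; thus `e 0, e 2` and `e 1, e 3` are the pairs of opposite
edges. -/
def IsFourCycle {α β : Type*} (G : Graph α β) (v : Fin 4 → α) (e : Fin 4 → β) : Prop :=
  Function.Injective v ∧ ∀ i : Fin 4, G.IsLink (e i) (v i) (v (i + 1))

end Graph

/-! Circuits are handled as minimal nonempty edge sets with zero boundary over `ZMod 2`, where a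
loop has zero boundary. Undoing suppressions turns distinct covers of `G₁` and `G₂` into distinct
covers of `G` without two opposite edges of the 4-cycle (`nu_le_encard_of_isSuppressionOf`). With c
counting covers without repeated members, it therefore suffices that 2c(G - {e 0, e 2}) + 2c(G - {e
1, e 3}) ≤ c(G), which is `Square.card_covers_le`; the factor 4 is 2 + 2.

Cut all members of a cover open by dropping the edges `e i`. What remains are strands: circuits off
the 4-cycle and paths with both ends on it. At a cubic vertex any two edges determine the member
through both, so no strand lies in two members, and the strands cover every edge off the 4-cycle
twice (`strandCover_strands`). Each third edge `f i` is thus in two strands, so there are exactly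
four paths, whose ends form one of six patterns (`exists_arranged`). The inequality is proved
separately for each family of strands (`card_fiber_le`).

If only `e r` and `e (r + 2)` are kept, a path whose ends are joined by a kept edge must be closed
by it; any other path must be joined through both kept edges to a disjoint path with the
complementary ends. Such a cover is determined by the pairing of paths (`exists_joining`). With all
four edges present there are more ways to close the paths, some having the 4-cycle itself as a
member; explicit ones are listed in `patternCovers`. For each pattern and each disjointness relation
between the paths, `length_joinings_le` compares the two counts by a finite check.

Cyclic connectivity and the exclusion of `K₄` serve only to make the third edges `f i` distinct and
different from all `e j` (`chordless`). Loops elsewhere are harmless: a loop in a cubic graph hangs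
on a bridge, which no even set contains, so either G - {e 0, e 2} has no cover and `G₁.nu = 0`, or
`G` is loopless (`IsFourCycle.square`). -/

section

open scoped Classical

/-! ### Boundaries mod 2, minimal even sets and their double covers -/

namespace CycleSpace

variable {α β : Type*}

/-- The mod-2 boundary at `x` of a finite edge set `F`, for the incidence relation `I`. -/
noncomputable def bd (I : β → α → Prop) (F : Finset β) (x : α) : ZMod 2 :=
  ∑ g ∈ F, if I g x then 1 else 0

/-- Elements of the binary cycle space. -/
def IsEven (I : β → α → Prop) (F : Finset β) : Prop := ∀ x, bd I F x = 0

/-- Minimal nonempty elements of the binary cycle space. -/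
def IsCirc (I : β → α → Prop) (F : Finset β) : Prop :=
  F.Nonempty ∧ IsEven I F ∧ ∀ F' ⊆ F, F'.Nonempty → IsEven I F' → F' = F

/-- The edge `g` has two distinct ends. -/
def HasEnds (I : β → α → Prop) (g : β) : Prop := ∃ x y, x ≠ y ∧ ∀ z, I g z ↔ z = x ∨ z = y

variable {I : β → α → Prop} {F F' : Finset β} {x y : α}

@[simp] lemma bd_empty : bd I ∅ x = 0 := by simp [bd]

lemma zmod2_cases (a : ZMod 2) : a = 0 ∨ a = 1 := by
  revert a; decide

lemma bd_union (h : Disjoint F F') : bd I (F ∪ F') x = bd I F x + bd I F' x :=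
  Finset.sum_union h

lemma bd_sdiff (h : F' ⊆ F) : bd I (F \ F') x = bd I F x + bd I F' x := by
  have h1 : bd I (F \ F') x + bd I F' x = bd I F x := Finset.sum_sdiff h
  rw [← h1, add_assoc, CharTwo.add_self_eq_zero, add_zero]

lemma bd_singleton (g : β) : bd I {g} x = if I g x then 1 else 0 :=
  Finset.sum_singleton _ _

lemma bd_star {a b c : β} (hab : a ≠ b) (hac : a ≠ c) (hbc : b ≠ c)
    (hx : ∀ g, I g x ↔ g = a ∨ g = b ∨ g = c) :
    bd I F x = (if a ∈ F then 1 else 0) + (if b ∈ F then 1 else 0) + (if c ∈ F then 1 else 0) := by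
  have h : ∀ g, (if I g x then (1 : ZMod 2) else 0) =
      (if g = a then 1 else 0) + (if g = b then 1 else 0) + (if g = c then 1 else 0) := by
    intro g
    rw [if_congr (hx g) rfl rfl]
    by_cases h1 : g = a
    · subst h1; simp [hab, hac]
    by_cases h2 : g = b
    · subst h2; simp [h1, hbc]
    simp [h1, h2]
  simp only [bd, h, Finset.sum_add_distrib, Finset.sum_ite_eq']

/-- Evenness at a vertex of degree three, propositionally. -/
lemma bd_star_eq_zero {a b c : β} (hab : a ≠ b) (hac : a ≠ c) (hbc : b ≠ c)
    (hx : ∀ g, I g x ↔ g = a ∨ g = b ∨ g = c) :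
    bd I F x = 0 ↔ ((a ∈ F → (b ∈ F ↔ c ∉ F)) ∧ (a ∉ F → (b ∈ F ↔ c ∈ F))) := by
  rw [bd_star hab hac hbc hx]
  by_cases h1 : a ∈ F <;> by_cases h2 : b ∈ F <;> by_cases h3 : c ∈ F <;> simp [h1, h2, h3] <;> decide

lemma bd_isolated (hx : ∀ g, ¬ I g x) : bd I F x = 0 := by simp [bd, hx]

lemma bd_congr {J : β → α → Prop} (h : ∀ g ∈ F, I g x ↔ J g x) : bd I F x = bd J F x :=
  Finset.sum_congr rfl fun g hg => if_congr (h g hg) rfl rfl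

lemma exists_inc_of_bd (h : bd I F x = 1) : ∃ g ∈ F, I g x := by
  by_contra! hc
  rw [bd, Finset.sum_eq_zero] at h
  · exact zero_ne_one h
  · intro g hg; simp [hc g hg]

/-- Some part of an edge set joins a given odd vertex to another odd vertex. -/
lemma exists_path (hF : ∀ g ∈ F, HasEnds I g) (hx : bd I F x = 1) :
    ∃ y, y ≠ x ∧ bd I F y = 1 ∧ ∃ F' ⊆ F, ∀ z, bd I F' z = if z = x ∨ z = y then 1 else 0 := by
  induction hn : F.card using Nat.strong_induction_on generalizing F x with
  | _ n ih =>
    obtain ⟨g, hg, hgx⟩ := exists_inc_of_bd hx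
    obtain ⟨z, hzx, hz⟩ : ∃ z, z ≠ x ∧ ∀ w, I g w ↔ w = x ∨ w = z := by
      obtain ⟨a, b, hab, h⟩ := hF g hg
      rcases (h x).1 hgx with rfl | rfl
      · exact ⟨b, hab.symm, h⟩
      · exact ⟨a, hab, fun w => by rw [h w, or_comm]⟩
    have hb : ∀ w, bd I (F.erase g) w = bd I F w + if w = x ∨ w = z then 1 else 0 := by
      intro w
      rw [Finset.erase_eq, bd_sdiff (by simpa using hg), bd_singleton, if_congr (hz w) rfl rfl]
    -- Deleting `g` moves the oddness of `x` along `g` to `z`. If `z` was even it is now odd and the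
    -- walk continues from there; if it was odd, `g` alone is the path.
    rcases zmod2_cases (bd I F z) with h0 | h1
    · have hz1 : bd I (F.erase g) z = 1 := by rw [hb]; simp [h0]
      obtain ⟨y, hyz, hy, F', hF', hbF'⟩ := ih _ (by rw [← hn]; exact Finset.card_erase_lt_of_mem hg)
        (fun k hk => hF k (Finset.mem_of_mem_erase hk)) hz1 rfl
      have hyx : y ≠ x := by
        rintro rfl
        rw [hb, hx] at hy
        simp at hy
      refine ⟨y, hyx, ?_, insert g F', ?_, ?_⟩
      · rw [hb] at hy; simpa [hyx, hyz] using hy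
      · exact Finset.insert_subset hg (hF'.trans (Finset.erase_subset _ _))
      · intro w
        have hgF' : g ∉ F' := fun h => by simpa using hF' h
        rw [Finset.insert_eq, bd_union (by simpa using hgF'), bd_singleton,
          if_congr (hz w) rfl rfl, hbF']
        by_cases h1 : w = x
        · subst h1; simp [hzx.symm, hyx.symm]
        · by_cases h2 : w = z
          · subst h2; simp [h1, hyz.symm]; decide
          · simp [h1, h2]
    · exact ⟨z, hzx, h1, {g}, by simpa using hg, fun w => by
        rw [bd_singleton, if_congr (hz w) rfl rfl]⟩

/-- The family of all circuit double covers (without repeated members) of the edge set `E`. -/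
noncomputable def covers (I : β → α → Prop) (E : Finset β) : Finset (Finset (Finset β)) :=
  E.powerset.powerset.filter fun D =>
    (∀ F ∈ D, IsCirc I F) ∧ ∀ g ∈ E, (D.filter (g ∈ ·)).card = 2

lemma mem_covers {E : Finset β} {D : Finset (Finset β)} : D ∈ covers I E ↔
    (∀ F ∈ D, F ⊆ E ∧ IsCirc I F) ∧ ∀ g ∈ E, (D.filter (g ∈ ·)).card = 2 := by
  simp only [covers, Finset.mem_filter, Finset.mem_powerset, Finset.subset_iff (s₁ := D)]
  constructor
  · rintro ⟨h1, h2, h3⟩; exact ⟨fun F hF => ⟨h1 hF, h2 F hF⟩, h3⟩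
  · rintro ⟨h1, h2⟩; exact ⟨fun F hF => (h1 F hF).1, fun F hF => (h1 F hF).2, h2⟩

/-- At a vertex of degree three, each pair of edges lies in exactly one member of a double
cover by even sets. -/
lemma countP_pair {D : Multiset (Finset β)} (hD : ∀ F ∈ D, IsEven I F) {a b c : β}
    (hab : a ≠ b) (hac : a ≠ c) (hbc : b ≠ c) (hx : ∀ g, I g x ↔ g = a ∨ g = b ∨ g = c)
    (h : ∀ g, I g x → D.countP (g ∈ ·) = 2) : D.countP (fun F => a ∈ F ∧ b ∈ F) = 1 := by
  -- An even set contains none or exactly two of `a`, `b`, `c`, so each member satisfies this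
  -- identity by itself. With all three counts equal to 2 it reads 2 + 2 = 2 + 2 · 1.
  have key : ∀ D : Multiset (Finset β), (∀ F ∈ D, IsEven I F) →
      D.countP (a ∈ ·) + D.countP (b ∈ ·) =
        D.countP (c ∈ ·) + 2 * D.countP (fun F => a ∈ F ∧ b ∈ F) := by
    intro D
    induction D using Multiset.induction with
    | empty => simp
    | cons F D ih =>
      intro hD
      have h1 := ih fun F hF => hD F (Multiset.mem_cons_of_mem hF)
      have h2 := (bd_star_eq_zero hab hac hbc hx).1 (hD F (Multiset.mem_cons_self F D) x)
      simp only [Multiset.countP_cons]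
      by_cases ha : a ∈ F <;> by_cases hb : b ∈ F <;> by_cases hc : c ∈ F <;>
        simp [ha, hb, hc] at h2 ⊢ <;> omega
  have := key D hD
  rw [h a ((hx a).2 (by simp)), h b ((hx b).2 (by simp)), h c ((hx c).2 (by simp))] at this
  omega

end CycleSpace

end

/-! ### Strands: cutting a cover open at the 4-cycle -/

section

open scoped Classical

namespace CycleSpace

variable {α β : Type*}

/-- A 4-cycle `v 0, v 1, v 2, v 3` with edges `e i = v i v (i+1)` and no chords in a loopless cubic
graph with edge set `E`; the third edge at `v i` is `f i`. -/
structure Square (I : β → α → Prop) (E : Finset β) (v : Fin 4 → α) (e f : Fin 4 → β) : Prop where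
  v_inj : Function.Injective v
  e_inj : Function.Injective e
  f_inj : Function.Injective f
  e_ne_f : ∀ i j, e i ≠ f j
  star_v : ∀ i g, I g (v i) ↔ g = e i ∨ g = e (i - 1) ∨ g = f i
  star_out : ∀ x ∉ Set.range v, (∀ g, ¬ I g x) ∨
    ∃ a b c, a ≠ b ∧ a ≠ c ∧ b ≠ c ∧ ∀ g, I g x ↔ g = a ∨ g = b ∨ g = c
  ends : ∀ g ∈ E, HasEnds I g
  mem : ∀ g x, I g x → g ∈ E

/-- Edge sets that avoid the edges `e i` and are even outside the vertices `v i`. -/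
def OutEven (I : β → α → Prop) (E : Finset β) (v : Fin 4 → α) (e : Fin 4 → β)
    (F : Finset β) : Prop :=
  F ⊆ E ∧ (∀ i, e i ∉ F) ∧ ∀ x ∉ Set.range v, bd I F x = 0

/-- Minimal nonempty edge sets as in `OutEven`: circuits avoiding the 4-cycle, and paths with
both ends on it. -/
def Strand (I : β → α → Prop) (E : Finset β) (v : Fin 4 → α) (e : Fin 4 → β)
    (F : Finset β) : Prop :=
  F.Nonempty ∧ OutEven I E v e F ∧ ∀ F' ⊆ F, F'.Nonempty → OutEven I E v e F' → F' = F

/-- The strands contained in the members of `D`. -/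
noncomputable def strands (I : β → α → Prop) (E : Finset β) (v : Fin 4 → α) (e : Fin 4 → β)
    (D : Finset (Finset β)) : Finset (Finset β) :=
  E.powerset.filter fun F => Strand I E v e F ∧ ∃ C ∈ D, F ⊆ C

/-- The indices of the ends of a strand. -/
noncomputable def endsOf (f : Fin 4 → β) (F : Finset β) : Finset (Fin 4) :=
  Finset.univ.filter fun i => f i ∈ F

/-- Double covers by strands. -/
def StrandCover (I : β → α → Prop) (E : Finset β) (v : Fin 4 → α) (e : Fin 4 → β)
    (O : Finset (Finset β)) : Prop :=
  (∀ F ∈ O, Strand I E v e F) ∧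
    ∀ g ∈ E, (∀ i, g ≠ e i) → (O.filter (g ∈ ·)).card = 2

variable {I : β → α → Prop} {E : Finset β} {v : Fin 4 → α} {e f : Fin 4 → β}
  {F F' P W : Finset β} {x : α}

lemma mem_strands {D : Finset (Finset β)} :
    F ∈ strands I E v e D ↔ Strand I E v e F ∧ ∃ C ∈ D, F ⊆ C := by
  simp only [strands, Finset.mem_filter, Finset.mem_powerset, and_iff_right_iff_imp]
  exact fun h => h.1.2.1.1

@[simp] lemma mem_endsOf {i : Fin 4} : i ∈ endsOf f F ↔ f i ∈ F := by simp [endsOf]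

lemma fin4_sub_one_ne (i : Fin 4) : i - 1 ≠ i := by revert i; decide
lemma fin4_add_one_ne (i : Fin 4) : i + 1 ≠ i := by revert i; decide

namespace Square

lemma e_ne_pred (h : Square I E v e f) (i : Fin 4) : e i ≠ e (i - 1) :=
  fun h' => fin4_sub_one_ne i (h.e_inj h').symm

lemma inc_e (h : Square I E v e f) (i : Fin 4) (x : α) : I (e i) x ↔ x = v i ∨ x = v (i + 1) := by
  have h1 : I (e i) (v i) := (h.star_v i _).2 (Or.inl rfl)
  have h2 : I (e i) (v (i + 1)) := (h.star_v (i + 1) _).2 (Or.inr (Or.inl (by simp)))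
  have h3 : v i ≠ v (i + 1) := fun h' => fin4_add_one_ne i (h.v_inj h').symm
  obtain ⟨a, b, -, hz⟩ := h.ends _ (h.mem _ _ h1)
  rw [hz] at h1 h2 ⊢
  grind

lemma e_mem (h : Square I E v e f) (i : Fin 4) : e i ∈ E :=
  h.mem _ (v i) ((h.star_v i _).2 (Or.inl rfl))

lemma f_mem (h : Square I E v e f) (i : Fin 4) : f i ∈ E :=
  h.mem _ (v i) ((h.star_v i _).2 (Or.inr (Or.inr rfl)))

lemma not_inc_e (h : Square I E v e f) (hx : x ∉ Set.range v) (i : Fin 4) : ¬ I (e i) x := by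
  rw [h.inc_e]
  rintro (rfl | rfl) <;> exact hx ⟨_, rfl⟩

lemma ne_e_of_inc (h : Square I E v e f) (hx : x ∉ Set.range v) {g : β} (hg : I g x) (i : Fin 4) :
    g ≠ e i := by
  rintro rfl; exact h.not_inc_e hx i hg

/-- An edge off the 4-cycle with both ends on it would be the third edge at two different vertices,
against the injectivity of `f`. -/
lemma exists_outer (h : Square I E v e f) {g : β} (hg : g ∈ E) (hge : ∀ i, g ≠ e i) :
    ∃ x ∉ Set.range v, I g x := by
  obtain ⟨a, b, hab, hz⟩ := h.ends g hg
  have key : ∀ i, I g (v i) → g = f i := fun i hi => by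
    rcases (h.star_v i g).1 hi with h' | h' | h'
    · exact absurd h' (hge _)
    · exact absurd h' (hge _)
    · exact h'
  by_contra! hc
  have ha : a ∈ Set.range v := by
    by_contra h'; exact hc a h' ((hz a).2 (Or.inl rfl))
  have hb : b ∈ Set.range v := by
    by_contra h'; exact hc b h' ((hz b).2 (Or.inr rfl))
  obtain ⟨i, rfl⟩ := ha
  obtain ⟨j, rfl⟩ := hb
  have h1 := key i ((hz _).2 (Or.inl rfl))
  have h2 := key j ((hz _).2 (Or.inr rfl))
  exact hab (by rw [h.f_inj (h1.symm.trans h2)])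

lemma bd_v (h : Square I E v e f) (i : Fin 4) : bd I F (v i) =
    (if e i ∈ F then 1 else 0) + (if e (i - 1) ∈ F then 1 else 0) + (if f i ∈ F then 1 else 0) :=
  bd_star (h.e_ne_pred i) (h.e_ne_f _ _) (h.e_ne_f _ _) (h.star_v i)

lemma bd_v_outEven (h : Square I E v e f) (hF : OutEven I E v e F) (i : Fin 4) :
    bd I F (v i) = if i ∈ endsOf f F then 1 else 0 := by
  rw [h.bd_v]; simp [hF.2.1]

lemma isEven_of_outEven (h : Square I E v e f) (hF : OutEven I E v e F) (h0 : endsOf f F = ∅) :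
    IsEven I F := by
  intro x
  by_cases hx : x ∈ Set.range v
  · obtain ⟨i, rfl⟩ := hx
    rw [h.bd_v_outEven hF, h0]; simp
  · exact hF.2.2 x hx

lemma outEven_sdiff (hF : OutEven I E v e F) (hF' : OutEven I E v e F') (hs : F' ⊆ F) :
    OutEven I E v e (F \ F') :=
  ⟨Finset.sdiff_subset.trans hF.1, fun i hi => hF.2.1 i (Finset.sdiff_subset hi),
    fun x hx => by rw [bd_sdiff hs, hF.2.2 x hx, hF'.2.2 x hx, add_zero]⟩

lemma bd_sdiff_e (h : Square I E v e f) (hx : x ∉ Set.range v) :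
    bd I (F \ Finset.univ.image e) x = bd I F x := by
  rw [← Finset.sdiff_inter_self_left, bd_sdiff Finset.inter_subset_left, bd, bd,
    Finset.sum_eq_zero (s := F ∩ _), add_zero]
  intro g hg
  simp only [Finset.mem_inter, Finset.mem_image, Finset.mem_univ, true_and] at hg
  obtain ⟨-, i, rfl⟩ := hg
  rw [if_neg (h.not_inc_e hx i)]

lemma outEven_of_isEven (h : Square I E v e f) (hE : F ⊆ E) (hF : IsEven I F) :
    OutEven I E v e (F \ Finset.univ.image e) :=
  ⟨Finset.sdiff_subset.trans hE, fun i => by simp,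
    fun x hx => by rw [h.bd_sdiff_e hx]; exact hF x⟩

/-- A strand in an even set `W` is contained in or disjoint from every even subset of `W`. -/
lemma subset_or_disjoint (h : Square I E v e f) (hP : Strand I E v e P) (hPW : P ⊆ W) (hFW : F ⊆ W)
    (hW : ∀ x ∉ Set.range v, bd I W x = 0) (hF : ∀ x ∉ Set.range v, bd I F x = 0) :
    P ⊆ F ∨ Disjoint P F := by
  -- At an outer vertex `P`, `F` and `W` each use none or two of the three edges. Since `P` and `F`
  -- lie in `W`, they agree there as soon as both use some edge, so the intersection is even as
  -- well.
  have hout : OutEven I E v e (P ∩ F) := by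
    refine ⟨Finset.inter_subset_left.trans hP.2.1.1,
      fun i hi => hP.2.1.2.1 i (Finset.inter_subset_left hi), fun x hx => ?_⟩
    rcases h.star_out x hx with h0 | ⟨a, b, c, hab, hac, hbc, hs⟩
    · exact bd_isolated h0
    · have h1 := (bd_star_eq_zero hab hac hbc hs).1 (hP.2.1.2.2 x hx)
      have h2 := (bd_star_eq_zero hab hac hbc hs).1 (hW x hx)
      have h3 := (bd_star_eq_zero hab hac hbc hs).1 (hF x hx)
      rw [bd_star_eq_zero hab hac hbc hs]
      have := @hPW a; have := @hPW b; have := @hPW c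
      have := @hFW a; have := @hFW b; have := @hFW c
      simp only [Finset.mem_inter]
      clear hs hP hW hF hPW hFW
      by_cases a ∈ P <;> by_cases b ∈ P <;> by_cases c ∈ P <;> simp_all
  rcases (P ∩ F).eq_empty_or_nonempty with h0 | h0
  · exact Or.inr (Finset.disjoint_iff_inter_eq_empty.2 h0)
  · exact Or.inl (Finset.inter_eq_left.1 (hP.2.2 _ Finset.inter_subset_left h0 hout))

lemma strand_eq_or_disjoint (h : Square I E v e f) (hP : Strand I E v e P) (hF : Strand I E v e F)
    (hPW : P ⊆ W) (hFW : F ⊆ W) (hW : ∀ x ∉ Set.range v, bd I W x = 0) :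
    P = F ∨ Disjoint P F :=
  (h.subset_or_disjoint hP hPW hFW hW hF.2.1.2.2).imp_left fun h' => hF.2.2 _ h' hP.1 hP.2.1

/-- Differences of nested outer-even sets are outer-even, so a set that is not minimal can be shrunk
to a proper part still containing `g`. -/
lemma exists_strand (hF : OutEven I E v e F) {g : β} (hg : g ∈ F) :
    ∃ P ⊆ F, Strand I E v e P ∧ g ∈ P := by
  induction F using Finset.strongInduction with
  | _ F ih =>
    by_cases hs : Strand I E v e F
    · exact ⟨F, subset_rfl, hs, hg⟩
    · have : ∃ F' ⊆ F, F'.Nonempty ∧ OutEven I E v e F' ∧ F' ≠ F := by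
        by_contra! hc
        exact hs ⟨⟨g, hg⟩, hF, hc⟩
      obtain ⟨F', hsub, hne, hF', hneq⟩ := this
      by_cases hg' : g ∈ F'
      · obtain ⟨P, hP, h⟩ := ih F' (hsub.ssubset_of_ne hneq) hF' hg'
        exact ⟨P, hP.trans hsub, h⟩
      · obtain ⟨P, hP, h⟩ := ih (F \ F') (Finset.sdiff_ssubset hsub hne)
          (outEven_sdiff hF hF' hsub) (Finset.mem_sdiff.2 ⟨hg, hg'⟩)
        exact ⟨P, hP.trans Finset.sdiff_subset, h⟩

/-- A strand ends at two different vertices of the 4-cycle, or nowhere. -/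
lemma endsOf_strand (h : Square I E v e f) (hP : Strand I E v e P) {i : Fin 4}
    (hi : i ∈ endsOf f P) : ∃ j, j ≠ i ∧ endsOf f P = {i, j} := by
  have h1 : bd I P (v i) = 1 := by rw [h.bd_v_outEven hP.2.1]; simp [hi]
  -- The part of `P` leading from `v i` to another odd vertex is itself outer-even, hence all of `P`
  -- by minimality; its only odd vertices are its two ends.
  obtain ⟨y, hy, hby, F', hF', hb⟩ := exists_path (fun g hg => h.ends g (hP.2.1.1 hg)) h1
  obtain ⟨j, rfl⟩ : y ∈ Set.range v := by
    by_contra hc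
    rw [hP.2.1.2.2 y hc] at hby
    exact zero_ne_one hby
  have hF'o : OutEven I E v e F' := by
    refine ⟨hF'.trans hP.2.1.1, fun k hk => hP.2.1.2.1 k (hF' hk), fun x hx => ?_⟩
    rw [hb, if_neg]
    rintro (rfl | rfl) <;> exact hx ⟨_, rfl⟩
  have hne : F'.Nonempty := by
    rw [Finset.nonempty_iff_ne_empty]
    rintro rfl
    have := hb (v i)
    simp at this
  obtain rfl := hP.2.2 F' hF' hne hF'o
  refine ⟨j, fun h' => hy (by rw [h']), ?_⟩
  ext k
  have := hb (v k)
  rw [h.bd_v_outEven hF'o] at this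
  simp only [h.v_inj.eq_iff] at this
  by_cases hk : k = i ∨ k = j <;> by_cases hk' : k ∈ endsOf f F' <;> simp_all

/-- A nonempty outer-even set has two edges at some outer vertex. -/
lemma exists_pair (h : Square I E v e f) {g : β} (hgE : g ∈ E) (hge : ∀ i, g ≠ e i) :
    ∃ x a b, a ≠ g ∧ b ≠ g ∧ a ≠ b ∧ (∀ k, I k x ↔ k = g ∨ k = a ∨ k = b) ∧ x ∉ Set.range v ∧
      ∀ F, g ∈ F → bd I F x = 0 → a ∈ F ∨ b ∈ F := by
  obtain ⟨x, hx, hgx⟩ := h.exists_outer hgE hge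
  obtain h0 | ⟨a, b, c, hab, hac, hbc, hs⟩ := h.star_out x hx
  · exact absurd hgx (h0 g)
  obtain ⟨a, b, hab, hac, hbc, hs⟩ :
      ∃ a b, a ≠ g ∧ b ≠ g ∧ a ≠ b ∧ (∀ k, I k x ↔ k = g ∨ k = a ∨ k = b) := by
    rcases (hs g).1 hgx with rfl | rfl | rfl
    · exact ⟨b, c, hab.symm, hac.symm, hbc, hs⟩
    · exact ⟨a, c, hab, hbc.symm, hac, fun k => by rw [hs]; tauto⟩
    · exact ⟨a, b, hac, hbc, hab, fun k => by rw [hs]; tauto⟩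
  refine ⟨x, a, b, hab, hac, hbc, hs, hx, fun F hgF hF => ?_⟩
  have := (bd_star_eq_zero hab.symm hac.symm hbc hs).1 hF
  tauto

/-- `E'` contains all edges off the 4-cycle. -/
def Outer (E E' : Finset β) (e : Fin 4 → β) : Prop := E' ⊆ E ∧ ∀ g ∈ E, (∀ i, g ≠ e i) → g ∈ E'

variable {E' : Finset β}

/-- At an outer end of `g` the set `P` contains a second edge, and by `countP_pair` only one member
of the cover contains both. This gives both that a strand determines its member and that members
leaving the 4-cycle are not repeated. -/
lemma count_le_one (h : Square I E v e f) (hE' : Outer E E' e) {D : Multiset (Finset β)}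
    (hD : ∀ C ∈ D, IsEven I C) (hD' : ∀ g ∈ E', D.countP (g ∈ ·) = 2)
    {P : Finset β} {g : β} (hg : g ∈ P) (hgE : g ∈ E) (hge : ∀ i, g ≠ e i)
    (hP : ∀ x ∉ Set.range v, bd I P x = 0) : D.countP (P ⊆ ·) ≤ 1 := by
  obtain ⟨x, a, b, hag, hbg, hab, hs, hx, hF⟩ := h.exists_pair hgE hge
  have hc : ∀ k, I k x → D.countP (k ∈ ·) = 2 := fun k hk =>
    hD' k (hE'.2 k (h.mem k x hk) (h.ne_e_of_inc hx hk))
  rcases hF P hg (hP x hx) with hm | hm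
  · rw [← countP_pair hD hag.symm hbg.symm hab hs hc, Multiset.countP_eq_card_filter,
      Multiset.countP_eq_card_filter]
    exact Multiset.card_le_card (Multiset.monotone_filter_right _ fun C hC => ⟨hC hg, hC hm⟩)
  · have := countP_pair (c := a) hD hbg.symm hag.symm hab.symm
      (fun k => by rw [hs]; tauto) hc
    rw [← this, Multiset.countP_eq_card_filter, Multiset.countP_eq_card_filter]
    exact Multiset.card_le_card (Multiset.monotone_filter_right _ fun C hC => ⟨hC hg, hC hm⟩)

lemma eq_of_strand_subset (h : Square I E v e f) (hE' : Outer E E' e) {D : Finset (Finset β)}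
    (hD : D ∈ covers I E') (hP : Strand I E v e P) {C C' : Finset β} (hC : C ∈ D) (hC' : C' ∈ D)
    (hPC : P ⊆ C) (hPC' : P ⊆ C') : C = C' := by
  rw [mem_covers] at hD
  obtain ⟨g, hg⟩ := hP.1
  have := h.count_le_one hE' (D := D.val) (fun C hC => (hD.1 C hC).2.2.1)
    (fun g hg => by rw [← hD.2 g hg, Multiset.countP_eq_card_filter]; rfl) hg (hP.2.1.1 hg)
    (fun i hi => hP.2.1.2.1 i (hi ▸ hg)) hP.2.1.2.2
  rw [Multiset.countP_eq_card_filter] at this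
  change (D.filter (P ⊆ ·)).card ≤ 1 at this
  exact Finset.card_le_one.1 this C (by simp [hC, hPC]) C' (by simp [hC', hPC'])

lemma exists_strand_of_mem (h : Square I E v e f) {C : Finset β} (hCE : C ⊆ E) (hC : IsEven I C)
    {g : β} (hg : g ∈ C) (hge : ∀ i, g ≠ e i) : ∃ P ⊆ C, Strand I E v e P ∧ g ∈ P := by
  obtain ⟨P, hP, h1, h2⟩ := exists_strand (g := g) (h.outEven_of_isEven hCE hC)
    (by simpa [hg] using fun i => (hge i).symm)
  exact ⟨P, hP.trans Finset.sdiff_subset, h1, h2⟩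

/-- For an edge `g` off the 4-cycle, sending a member through `g` to its strand through `g` is a
bijection: strands within one member are equal or disjoint, and a strand lies in only one member. -/
lemma strandCover_strands (h : Square I E v e f) (hE' : Outer E E' e) {D : Finset (Finset β)}
    (hD : D ∈ covers I E') : StrandCover I E v e (strands I E v e D) := by
  have hD' := mem_covers.1 hD
  refine ⟨fun F hF => (mem_strands.1 hF).1, fun g hg hge => ?_⟩
  rw [← hD'.2 g (hE'.2 g hg hge)]
  symm
  have hex : ∀ C (hC : C ∈ D.filter (g ∈ ·)), ∃ P ⊆ C, Strand I E v e P ∧ g ∈ P := by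
    intro C hC
    rw [Finset.mem_filter] at hC
    exact h.exists_strand_of_mem ((hD'.1 C hC.1).1.trans hE'.1) (hD'.1 C hC.1).2.2.1 hC.2 hge
  choose p hp1 hp2 hp3 using hex
  refine Finset.card_bij p ?_ ?_ ?_
  · intro C hC
    have := (Finset.mem_filter.1 hC).1
    rw [Finset.mem_filter, mem_strands]
    exact ⟨⟨hp2 C hC, C, this, hp1 C hC⟩, hp3 C hC⟩
  · intro C hC C' hC' heq
    exact h.eq_of_strand_subset hE' hD (hp2 C hC) (Finset.mem_filter.1 hC).1
      (Finset.mem_filter.1 hC').1 (hp1 C hC) (heq ▸ hp1 C' hC')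
  · intro F hF
    rw [Finset.mem_filter, mem_strands] at hF
    obtain ⟨⟨hF, C, hC, hFC⟩, hgF⟩ := hF
    have hC' : C ∈ D.filter (g ∈ ·) := Finset.mem_filter.2 ⟨hC, hFC hgF⟩
    refine ⟨C, hC', ?_⟩
    refine (h.strand_eq_or_disjoint (hp2 C hC') hF (hp1 C hC') hFC
      fun x _ => (hD'.1 C hC).2.2.1 x).resolve_right fun hd => ?_
    exact Finset.disjoint_left.1 hd (hp3 C hC') hgF

end Square

end CycleSpace

end

/-! ### Finite tables: end patterns, symbolic covers and joinings -/

namespace CycleSpace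

/-- Symbolic members of a cover: a set of (indices of) outer paths, and a set of edges `e i`. -/
abbrev Piece := Finset (Fin 4) × Finset (Fin 4)

/-- The parity of the boundary at `v j` of a piece, where `n k` is the set of ends of the `k`-th
outer path. -/
def pieceBd (n : Fin 4 → Finset (Fin 4)) (p : Piece) (j : Fin 4) : ℕ :=
  ((p.1.filter (j ∈ n ·)).card + (p.2.filter fun i => j = i ∨ j = i + 1).card) % 2

/-- Minimal nonempty pieces without boundary. -/
def PieceCirc (n : Fin 4 → Finset (Fin 4)) (p : Piece) : Prop :=
  p ≠ (∅, ∅) ∧ (∀ j, pieceBd n p j = 0) ∧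
    ∀ S ∈ p.1.powerset, ∀ T ∈ p.2.powerset, (∀ j, pieceBd n (S, T) j = 0) →
      (S, T) = (∅, ∅) ∨ (S, T) = p

instance (n : Fin 4 → Finset (Fin 4)) (p : Piece) : Decidable (PieceCirc n p) := by
  unfold PieceCirc; infer_instance

/-- A symbolic double cover of the 4-cycle using each outer path once. -/
def PieceCover (n : Fin 4 → Finset (Fin 4)) (X : List Piece) : Prop :=
  (∀ p ∈ X, PieceCirc n p) ∧ X.Nodup ∧ (∀ k, X.countP (k ∈ ·.1) = 1) ∧
    ∀ i, X.countP (i ∈ ·.2) = 2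

instance (n : Fin 4 → Finset (Fin 4)) (X : List Piece) : Decidable (PieceCover n X) := by
  unfold PieceCover; infer_instance

/-- The possible patterns of the ends of the four outer paths. -/
def pattern : Fin 6 → Fin 4 → Finset (Fin 4) :=
  ![![{0, 3}, {0, 3}, {1, 2}, {1, 2}], ![{0, 1}, {0, 1}, {2, 3}, {2, 3}],
    ![{0, 2}, {0, 2}, {1, 3}, {1, 3}], ![{0, 1}, {1, 2}, {2, 3}, {0, 3}],
    ![{0, 2}, {2, 3}, {1, 3}, {0, 1}], ![{1, 3}, {0, 3}, {0, 2}, {1, 2}]]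

/-- For each pattern, some symbolic double covers, each with the pairs of paths that are joined. -/
def patternCovers : Fin 6 → List (List Piece × List (Fin 4 × Fin 4)) :=
  ![[([({0}, {3}), ({1}, {0, 1, 2}), ({2}, {1}), ({3}, {0, 2, 3})], []),
      ([({1}, {3}), ({0}, {0, 1, 2}), ({2}, {1}), ({3}, {0, 2, 3})], []),
      ([({0}, {3}), ({1}, {0, 1, 2}), ({3}, {1}), ({2}, {0, 2, 3})], []),
      ([({1}, {3}), ({0}, {0, 1, 2}), ({3}, {1}), ({2}, {0, 2, 3})], []),
      ([({1}, {3}), ({3}, {1}), ({0, 2}, {0, 2}), (∅, {0, 1, 2, 3})], [(0, 2)]),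
      ([({1}, {3}), ({2}, {1}), ({0, 3}, {0, 2}), (∅, {0, 1, 2, 3})], [(0, 3)]),
      ([({0}, {3}), ({3}, {1}), ({1, 2}, {0, 2}), (∅, {0, 1, 2, 3})], [(1, 2)]),
      ([({0}, {3}), ({2}, {1}), ({1, 3}, {0, 2}), (∅, {0, 1, 2, 3})], [(1, 3)])],
    [([({0}, {0}), ({1}, {1, 2, 3}), ({2}, {2}), ({3}, {0, 1, 3})], []),
      ([({1}, {0}), ({0}, {1, 2, 3}), ({2}, {2}), ({3}, {0, 1, 3})], []),
      ([({0}, {0}), ({1}, {1, 2, 3}), ({3}, {2}), ({2}, {0, 1, 3})], []),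
      ([({1}, {0}), ({0}, {1, 2, 3}), ({3}, {2}), ({2}, {0, 1, 3})], []),
      ([({1}, {0}), ({3}, {2}), ({0, 2}, {1, 3}), (∅, {0, 1, 2, 3})], [(0, 2)]),
      ([({1}, {0}), ({2}, {2}), ({0, 3}, {1, 3}), (∅, {0, 1, 2, 3})], [(0, 3)]),
      ([({0}, {0}), ({3}, {2}), ({1, 2}, {1, 3}), (∅, {0, 1, 2, 3})], [(1, 2)]),
      ([({0}, {0}), ({2}, {2}), ({1, 3}, {1, 3}), (∅, {0, 1, 2, 3})], [(1, 3)])],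
    [([({0}, {0, 1}), ({1}, {2, 3}), ({2}, {1, 2}), ({3}, {0, 3})], []),
      ([({1}, {0, 1}), ({0}, {2, 3}), ({2}, {1, 2}), ({3}, {0, 3})], []),
      ([({0}, {0, 1}), ({1}, {2, 3}), ({3}, {1, 2}), ({2}, {0, 3})], []),
      ([({1}, {0, 1}), ({0}, {2, 3}), ({3}, {1, 2}), ({2}, {0, 3})], []),
      ([({0, 2}, {0, 2}), ({1, 3}, {1, 3}), (∅, {0, 1, 2, 3})], [(0, 2), (1, 3)]),
      ([({0, 2}, {1, 3}), ({1, 3}, {0, 2}), (∅, {0, 1, 2, 3})], [(0, 2), (1, 3)]),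
      ([({0, 3}, {0, 2}), ({1, 2}, {1, 3}), (∅, {0, 1, 2, 3})], [(0, 3), (1, 2)]),
      ([({0, 3}, {1, 3}), ({1, 2}, {0, 2}), (∅, {0, 1, 2, 3})], [(0, 3), (1, 2)])],
    [([({0}, {0}), ({1}, {1}), ({2}, {2}), ({3}, {3}), (∅, {0, 1, 2, 3})], []),
      ([({0, 2}, {1, 3}), ({1, 3}, {0, 2}), (∅, {0, 1, 2, 3})], [(0, 2), (1, 3)]),
      ([({3}, {0, 1, 2}), ({1}, {0, 2, 3}), ({0, 2}, {1, 3})], [(0, 2)]),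
      ([({0}, {1, 2, 3}), ({2}, {0, 1, 3}), ({1, 3}, {0, 2})], [(1, 3)])],
    [([({0}, {2, 3}), ({1}, {0, 1, 3}), ({2}, {1, 2}), ({3}, {0})], []),
      ([({0}, {0, 1}), ({1}, {2}), ({2}, {0, 3}), ({3}, {1, 2, 3})], []),
      ([({3}, {0}), ({1}, {2}), ({0, 2}, {1, 3}), (∅, {0, 1, 2, 3})], [(0, 2)]),
      ([({3}, {1, 2, 3}), ({1}, {0, 1, 3}), ({0, 2}, {0, 2})], [(0, 2)]),
      ([({1, 3}, {1, 3}), ({0, 2}, {0, 2}), (∅, {0, 1, 2, 3})], [(1, 3), (0, 2)])],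
    [([({0}, {0, 3}), ({1}, {0, 1, 2}), ({2}, {2, 3}), ({3}, {1})], []),
      ([({0}, {1, 2}), ({1}, {3}), ({2}, {0, 1}), ({3}, {0, 2, 3})], []),
      ([({3}, {1}), ({1}, {3}), ({0, 2}, {0, 2}), (∅, {0, 1, 2, 3})], [(0, 2)]),
      ([({3}, {0, 2, 3}), ({1}, {0, 1, 2}), ({0, 2}, {1, 3})], [(0, 2)]),
      ([({1, 3}, {0, 2}), ({0, 2}, {1, 3}), (∅, {0, 1, 2, 3})], [(1, 3), (0, 2)])]]

/-- Distinctness is needed for the sets of pieces, since the order of a list is lost on gluing. -/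
lemma patternCovers_nodup (t : Fin 6) :
    ((patternCovers t).map fun X => X.1.toFinset).Nodup := by
  revert t; decide +kernel

lemma pieceCover_of_mem (t : Fin 6) : ∀ X ∈ patternCovers t, PieceCover (pattern t) X.1 := by
  revert t; decide +kernel

/-- Any two paths of the piece `p` are listed in `L`. -/
def JoinedBy (L : List (Fin 4 × Fin 4)) (p : Piece) : Prop :=
  ∀ k ∈ p.1, ∀ l ∈ p.1, k ≠ l → (k, l) ∈ L ∨ (l, k) ∈ L

instance (L : List (Fin 4 × Fin 4)) (p : Piece) : Decidable (JoinedBy L p) := by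
  unfold JoinedBy; infer_instance

lemma patternCovers_joinedBy (t : Fin 6) : ∀ X ∈ patternCovers t, ∀ p ∈ X.1, JoinedBy X.2 p := by
  revert t; decide +kernel

/-- Boolean encoding of a relation between `{0, 1}` and `{2, 3}`. -/
def table (a b c d : Bool) : Fin 4 → Fin 4 → Bool :=
  ![![false, false, a, b], ![false, false, c, d], ![a, c, false, false], ![b, d, false, false]]

/-- If the edges `e r` and `e (r + 2)` are kept: the ways in which outer paths with ends `n` can be
joined to circuits. -/
def Joining (r : Fin 4) (n : Fin 4 → Finset (Fin 4)) (π : Fin 4 → Fin 4) : Prop :=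
  (∀ k, π (π k) = k) ∧ ∀ k, if n k = {r, r + 1} ∨ n k = {r + 2, r + 3} then π k = k
    else n (π k) = (n k)ᶜ

instance (r : Fin 4) (n : Fin 4 → Finset (Fin 4)) (π : Fin 4 → Fin 4) :
    Decidable (Joining r n π) := by
  unfold Joining; infer_instance

/-- The joinings for each pattern if `e 0` and `e 2` are kept. -/
def joiningsZero : Fin 6 → List (Fin 4 → Fin 4) :=
  ![[![2, 3, 0, 1], ![3, 2, 1, 0]], [![0, 1, 2, 3]], [![2, 3, 0, 1], ![3, 2, 1, 0]],
    [![0, 3, 2, 1]], [![2, 1, 0, 3]], [![2, 3, 0, 1]]]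

/-- The joinings for each pattern if `e 1` and `e 3` are kept. -/
def joiningsOne : Fin 6 → List (Fin 4 → Fin 4) :=
  ![[![0, 1, 2, 3]], [![2, 3, 0, 1], ![3, 2, 1, 0]], [![2, 3, 0, 1], ![3, 2, 1, 0]],
    [![2, 1, 0, 3]], [![2, 3, 0, 1]], [![2, 1, 0, 3]]]

lemma joining_zero (t : Fin 6) (π : Fin 4 → Fin 4) (h : Joining 0 (pattern t) π) :
    π ∈ joiningsZero t := by
  revert t π; decide +kernel

lemma joining_one (t : Fin 6) (π : Fin 4 → Fin 4) (h : Joining 1 (pattern t) π) :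
    π ∈ joiningsOne t := by
  revert t π; decide +kernel

/-- The relation `d` holds for all pairs of paths joined by `π`. -/
def allowsJoining (d : Fin 4 → Fin 4 → Bool) (π : Fin 4 → Fin 4) : Bool :=
  decide (∀ k, π k ≠ k → d k (π k) = true)

/-- The relation `d` holds for all pairs in the list `L`. -/
def allowsPairs (d : Fin 4 → Fin 4 → Bool) (L : List (Fin 4 × Fin 4)) : Bool :=
  decide (∀ q ∈ L, d q.1 q.2 = true)

lemma allowsJoining_iff {d : Fin 4 → Fin 4 → Bool} {π : Fin 4 → Fin 4} :
    allowsJoining d π = true ↔ ∀ k, π k ≠ k → d k (π k) = true := decide_eq_true_iff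

lemma allowsPairs_iff {d : Fin 4 → Fin 4 → Bool} {L : List (Fin 4 × Fin 4)} :
    allowsPairs d L = true ↔ ∀ q ∈ L, d q.1 q.2 = true := decide_eq_true_iff

/-- The combinatorial heart, where the two factors 2 come from. Equality occurs when all four
Booleans are true, for patterns 2 (8 = 8) and 3 (4 = 4). Only relations between {0, 1} and {2, 3}
enter, because the patterns are ordered so that complementary end sets occur only across these
halves. -/
lemma length_joinings_le (t : Fin 6) (a b c d : Bool) :
    2 * ((joiningsOne t).filter (allowsJoining (table a b c d))).length +
      2 * ((joiningsZero t).filter (allowsJoining (table a b c d))).length ≤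
      ((patternCovers t).filter fun X => allowsPairs (table a b c d) X.2).length := by
  revert t a b c d; decide +kernel

end CycleSpace

/-! ### The six possible patterns of ends -/

section

open scoped Classical

namespace CycleSpace

variable {α β : Type*} {I : β → α → Prop} {E E' : Finset β} {v : Fin 4 → α} {e f : Fin 4 → β}
  {O : Finset (Finset β)}

/-- The paths among the members of `O` are the sets `P k`, with ends given by `n k`. -/
structure Arranged (f : Fin 4 → β) (O : Finset (Finset β)) (P : Fin 4 → Finset β)
    (n : Fin 4 → Finset (Fin 4)) : Prop where
  inj : Function.Injective P
  mem : ∀ k, P k ∈ O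
  ends : ∀ k, endsOf f (P k) = n k
  exhaust : ∀ F ∈ O, (endsOf f F).Nonempty → ∃ k, F = P k

lemma fin4_third (i : Fin 4) (h : i ≠ 0) : ∃ a b, a ≠ b ∧ a ≠ 0 ∧ a ≠ i ∧ b ≠ 0 ∧ b ≠ i ∧
    (∀ x, x = 0 ∨ x = i ∨ x = a ∨ x = b) ∧ a < b := by
  revert i; decide

lemma fin4_fourth (i j : Fin 4) (h : i ≠ 0 ∧ j ≠ 0 ∧ i ≠ j) : ∃ m, m ≠ 0 ∧ m ≠ i ∧ m ≠ j ∧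
    (∀ x, x = 0 ∨ x = i ∨ x = j ∨ x = m) := by
  revert i j; decide

lemma arranged_mk {A B C D : Finset β} {n : Fin 4 → Finset (Fin 4)} (hAB : A ≠ B) (hAC : A ≠ C)
    (hAD : A ≠ D) (hBC : B ≠ C) (hBD : B ≠ D) (hCD : C ≠ D) (hA : A ∈ O) (hB : B ∈ O) (hC : C ∈ O)
    (hD : D ∈ O) (eA : endsOf f A = n 0) (eB : endsOf f B = n 1) (eC : endsOf f C = n 2)
    (eD : endsOf f D = n 3)
    (hall : ∀ F ∈ O, (endsOf f F).Nonempty → F = A ∨ F = B ∨ F = C ∨ F = D) :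
    Arranged f O ![A, B, C, D] n where
  inj := by
    intro i j hij
    fin_cases i <;> fin_cases j <;> simp_all
  mem k := by fin_cases k <;> assumption
  ends k := by fin_cases k <;> assumption
  exhaust F hF hne := by
    rcases hall F hF hne with h | h | h | h
    exacts [⟨0, h⟩, ⟨1, h⟩, ⟨2, h⟩, ⟨3, h⟩]

/-- Each `f i` is in two strands and each path has two distinct ends, so the paths are the edges of
a loopless 2-regular multigraph on `Fin 4`. This is a pair of double edges or a 4-cycle, with three
labellings each. -/
lemma Square.exists_arranged (h : Square I E v e f) (hO : StrandCover I E v e O) :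
    ∃ t P, Arranged f O P (pattern t) := by
  have hends : ∀ F ∈ O, ∀ i ∈ endsOf f F, ∃ j, j ≠ i ∧ endsOf f F = {i, j} :=
    fun F hF i hi => h.endsOf_strand (hO.1 F hF) hi
  have hcard : ∀ i, (O.filter (i ∈ endsOf f ·)).card = 2 := fun i => by
    rw [← hO.2 (f i) (h.f_mem i) fun j => (h.e_ne_f j i).symm]
    congr 1; ext F; simp
  have hother : ∀ i, ∀ F ∈ O, i ∈ endsOf f F → ∃ F', F' ≠ F ∧ F' ∈ O ∧ i ∈ endsOf f F' ∧
      ∀ G ∈ O, i ∈ endsOf f G → G = F ∨ G = F' := by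
    intro i F hF hi
    obtain ⟨A, B, hAB, hs⟩ := Finset.card_eq_two.1 (hcard i)
    have hm : ∀ G, (G ∈ O ∧ i ∈ endsOf f G) ↔ G = A ∨ G = B := fun G => by
      rw [← Finset.mem_filter (p := fun F => i ∈ endsOf f F), hs]; simp
    have h1 := (hm A).2 (Or.inl rfl)
    have h2 := (hm B).2 (Or.inr rfl)
    rcases (hm F).1 ⟨hF, hi⟩ with rfl | rfl
    · exact ⟨B, hAB.symm, h2.1, h2.2, fun G hG hG' => (hm G).1 ⟨hG, hG'⟩⟩
    · exact ⟨A, hAB, h1.1, h1.2, fun G hG hG' => ((hm G).1 ⟨hG, hG'⟩).symm⟩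
  have hfirst : ∀ i, ∃ F ∈ O, i ∈ endsOf f F := fun i => by
    obtain ⟨F, hF⟩ := Finset.card_pos.1 (by rw [hcard i]; norm_num)
    exact ⟨F, (Finset.mem_filter.1 hF).1, (Finset.mem_filter.1 hF).2⟩
  obtain ⟨A, hA, hA0⟩ := hfirst 0
  obtain ⟨B, hBA, hB, hB0, h0⟩ := hother 0 A hA hA0
  obtain ⟨i, hi, hAi⟩ := hends A hA 0 hA0
  obtain ⟨j, hj, hBj⟩ := hends B hB 0 hB0
  -- The two paths at `v 0` have the same far end in the double-edge case and different far ends in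
  -- the 4-cycle case.
  by_cases hij : i = j
  · subst hij
    obtain ⟨a, b, hab, ha0, hai, hb0, hbi, hx, hlt⟩ := fin4_third i hi
    obtain ⟨B', hBA', hB', hBi', h1⟩ := hother i A hA (by simp [hAi])
    obtain rfl : B = B' := (h1 B hB (by simp [hBj])).resolve_left hBA
    have haA : a ∉ endsOf f A := by rw [hAi]; simp [ha0, hai]
    have haB : a ∉ endsOf f B := by rw [hBj]; simp [ha0, hai]
    have key : ∀ G ∈ O, a ∈ endsOf f G → endsOf f G = {a, b} := by
      intro G hG ha
      obtain ⟨c, hc, hGc⟩ := hends G hG a ha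
      have hcc : c ∈ endsOf f G := by simp [hGc]
      rcases hx c with rfl | rfl | rfl | rfl
      · rcases h0 G hG hcc with rfl | rfl
        exacts [absurd ha haA, absurd ha haB]
      · rcases h1 G hG hcc with rfl | rfl
        exacts [absurd ha haA, absurd ha haB]
      · exact absurd rfl hc
      · exact hGc
    obtain ⟨C, hC, hCa⟩ := hfirst a
    obtain ⟨D, hDC, hD, hDa, h2⟩ := hother a C hC hCa
    obtain ⟨D', hDC', hD', hDb', h3⟩ := hother b C hC (by simp [key C hC hCa])
    obtain rfl : D = D' := (h3 D hD (by simp [key D hD hDa])).resolve_left hDC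
    have eC := key C hC hCa
    have eD := key D hD hDa
    have hne : ∀ X Y, endsOf f X = {0, i} → endsOf f Y = {a, b} → X ≠ Y := by
      rintro X Y hX hY rfl
      have : (0 : Fin 4) ∈ ({a, b} : Finset (Fin 4)) := by rw [← hY, hX]; simp
      simp [ha0.symm, hb0.symm] at this
    have hall : ∀ F ∈ O, (endsOf f F).Nonempty → F = A ∨ F = B ∨ F = C ∨ F = D := by
      rintro F hF ⟨x, hxF⟩
      rcases hx x with rfl | rfl | rfl | rfl
      · rcases h0 F hF hxF with h | h <;> simp [h]
      · rcases h1 F hF hxF with h | h <;> simp [h]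
      · rcases h2 F hF hxF with h | h <;> simp [h]
      · rcases h3 F hF hxF with h | h <;> simp [h]
    have mk : ∀ t, pattern t 0 = {0, i} → pattern t 1 = {0, i} → pattern t 2 = {a, b} →
        pattern t 3 = {a, b} → ∃ t P, Arranged f O P (pattern t) := fun t t0 t1 t2 t3 =>
      ⟨t, _, arranged_mk hBA.symm (hne A C hAi eC) (hne A D hAi eD) (hne B C hBj eC) (hne B D hBj eD)
        hDC.symm hA hB hC hD (hAi.trans t0.symm) (hBj.trans t1.symm) (eC.trans t2.symm)
        (eD.trans t3.symm) hall⟩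
    have hfin : ∃ t, pattern t 0 = {0, i} ∧ pattern t 1 = {0, i} ∧ pattern t 2 = {a, b} ∧
        pattern t 3 = {a, b} := by
      clear * - hi ha0 hai hb0 hbi hlt
      revert i a b; decide
    obtain ⟨t, t0, t1, t2, t3⟩ := hfin
    exact mk t t0 t1 t2 t3
  · obtain ⟨m, hm0, hmi, hmj, hx⟩ := fin4_fourth i j ⟨hi, hj, hij⟩
    obtain ⟨C, hCA, hC, hCi, h1⟩ := hother i A hA (by simp [hAi])
    obtain ⟨D, hDB, hD, hDj, h2⟩ := hother j B hB (by simp [hBj])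
    obtain ⟨c, hc, hCc⟩ := hends C hC i hCi
    obtain ⟨d, hd, hDd⟩ := hends D hD j hDj
    have hcc : c ∈ endsOf f C := by simp [hCc]
    have hdd : d ∈ endsOf f D := by simp [hDd]
    have hji : j ≠ i := fun h => hij h.symm
    have hc0 : c ≠ 0 := by
      rintro rfl
      rcases h0 C hC hcc with h' | h'
      · exact hCA h'
      · rw [h', hBj] at hCi; simp [hi, hij] at hCi
    have hd0 : d ≠ 0 := by
      rintro rfl
      rcases h0 D hD hdd with h' | h'
      · rw [h', hAi] at hDj; simp [hj, hji] at hDj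
      · exact hDB h'
    -- If `C` ended at `j`, then `A`, `B`, `C` would form a triangle using up 0, `i` and `j`, and a
    -- path from `m` would have no second end.
    have hcm : c = m := by
      rcases hx c with h' | h' | h' | h'
      · exact absurd h' hc0
      · exact absurd h' hc
      · exfalso
        subst h'
        obtain ⟨G, hG, hGm⟩ := hfirst m
        obtain ⟨d', hd', hGd⟩ := hends G hG m hGm
        have hgd : d' ∈ endsOf f G := by simp [hGd]
        have hCD : C = D := (h2 C hC hcc).resolve_left (by
          rintro rfl; rw [hBj] at hCi; simp [hi, hij] at hCi)
        rcases hx d' with rfl | rfl | rfl | rfl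
        · rcases h0 G hG hgd with rfl | rfl
          · rw [hAi] at hGm; simp [hm0, hmi] at hGm
          · rw [hBj] at hGm; simp [hm0, hmj] at hGm
        · rcases h1 G hG hgd with rfl | rfl
          · rw [hAi] at hGm; simp [hm0, hmi] at hGm
          · rw [hCc] at hGm; simp [hmj, hmi] at hGm
        · rcases h2 G hG hgd with rfl | rfl
          · rw [hBj] at hGm; simp [hm0, hmj] at hGm
          · rw [← hCD, hCc] at hGm; simp [hmj, hmi] at hGm
        · exact hd' rfl
      · exact h'
    subst hcm
    have hdm : d = c := by
      rcases hx d with h' | h' | h' | h'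
      · exact absurd h' hd0
      · exfalso
        subst h'
        rcases h1 D hD hdd with rfl | rfl
        · rw [hAi] at hDj; simp [hj, hji] at hDj
        · rw [hCc] at hDj; simp [hji, hmj.symm] at hDj
      · exact absurd h' hd
      · exact h'
    subst hdm
    have hAD : A ≠ D := by rintro rfl; rw [hAi] at hdd; simp [hm0, hmi] at hdd
    have hBC : B ≠ C := by rintro rfl; rw [hBj] at hcc; simp [hm0, hmj] at hcc
    have hCD : C ≠ D := by
      rintro rfl; rw [hCc] at hDj; simp [hji, hmj.symm] at hDj
    obtain ⟨G, hGC, hG, hGm, h3⟩ := hother d C hC hcc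
    obtain rfl : D = G := (h3 D hD hdd).resolve_left hCD.symm
    have hall : ∀ F ∈ O, (endsOf f F).Nonempty → F = A ∨ F = B ∨ F = C ∨ F = D := by
      rintro F hF ⟨x, hxF⟩
      rcases hx x with rfl | rfl | rfl | rfl
      · rcases h0 F hF hxF with h | h <;> simp [h]
      · rcases h1 F hF hxF with h | h <;> simp [h]
      · rcases h2 F hF hxF with h | h <;> simp [h]
      · rcases h3 F hF hxF with h | h <;> simp [h]
    let Q : Fin 4 → Finset β := ![A, B, C, D]
    let N : Fin 4 → Finset (Fin 4) := ![{0, i}, {0, j}, {i, d}, {j, d}]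
    -- The three 4-cycles on the four indices are patterns 3, 4 and 5; `σ` puts the paths into the
    -- order used there.
    have hfin : ∃ t, ∃ σ : Fin 4 → Fin 4, (∀ k, pattern t k = N (σ k)) ∧ Function.Injective σ := by
      have : ∃ t, ∃ s0 s1 s2 s3 : Fin 4, (∀ k, pattern t k = N (![s0, s1, s2, s3] k)) ∧
          Function.Injective ![s0, s1, s2, s3] := by
        clear * - hi hj hij hm0 hmi hmj
        simp only [N]
        clear N
        revert i j d; decide +kernel
      obtain ⟨t, s0, s1, s2, s3, hh⟩ := this
      exact ⟨t, _, hh⟩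
    obtain ⟨t, σ, hσ, hinj⟩ := hfin
    have hQ : Arranged f O Q N := arranged_mk hBA.symm hCA.symm hAD hBC hDB.symm hCD hA hB hC hD
      hAi hBj hCc hDd hall
    refine ⟨t, Q ∘ σ, hQ.inj.comp hinj, fun k => hQ.mem _, fun k => ?_, fun F hF hne => ?_⟩
    · rw [hσ]; exact hQ.ends _
    · obtain ⟨k, rfl⟩ := hQ.exhaust F hF hne
      obtain ⟨l, rfl⟩ := (Finite.injective_iff_surjective.1 hinj) k
      exact ⟨l, rfl⟩

end CycleSpace

end

/-! ### Gluing outer paths to covers of the whole graph -/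

section

open scoped Classical

namespace CycleSpace

variable {α β : Type*} {I : β → α → Prop} {E E' : Finset β} {v : Fin 4 → α} {e f : Fin 4 → β}
  {O : Finset (Finset β)} {P : Fin 4 → Finset β} {n : Fin 4 → Finset (Fin 4)}

/-- The edge set described by a piece. -/
noncomputable def glue (P : Fin 4 → Finset β) (e : Fin 4 → β) (p : Piece) : Finset β :=
  p.1.biUnion P ∪ p.2.image e

/-- The paths of the piece `p` are pairwise disjoint. -/
def PieceDisjoint (P : Fin 4 → Finset β) (p : Piece) : Prop :=
  (p.1 : Set (Fin 4)).PairwiseDisjoint P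

lemma mem_glue {g : β} {p : Piece} :
    g ∈ glue P e p ↔ (∃ k ∈ p.1, g ∈ P k) ∨ ∃ i ∈ p.2, e i = g := by simp [glue]

lemma Arranged.strand (hO : StrandCover I E v e O) (hP : Arranged f O P n) (k : Fin 4) :
    Strand I E v e (P k) := hO.1 _ (hP.mem k)

section
variable (h : Square I E v e f) (hO : StrandCover I E v e O) (hP : Arranged f O P n)
include h hO hP

lemma Arranged.bd_glue {p : Piece} (hp : PieceDisjoint P p) (x : α) :
    bd I (glue P e p) x = (∑ k ∈ p.1, bd I (P k) x) + ∑ i ∈ p.2, if I (e i) x then 1 else 0 := by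
  have hd : Disjoint (p.1.biUnion P) (p.2.image e) := by
    rw [Finset.disjoint_left]
    intro g hg hg'
    obtain ⟨k, -, hk⟩ := Finset.mem_biUnion.1 hg
    obtain ⟨i, -, rfl⟩ := Finset.mem_image.1 hg'
    exact (hP.strand hO k).2.1.2.1 i hk
  rw [glue, bd_union hd]
  congr 1
  · exact Finset.sum_biUnion hp
  · exact Finset.sum_image fun i _ j _ hij => h.e_inj hij

lemma Arranged.bd_glue_out {p : Piece} (hp : PieceDisjoint P p) {x : α} (hx : x ∉ Set.range v) :
    bd I (glue P e p) x = 0 := by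
  rw [hP.bd_glue h hO hp, Finset.sum_eq_zero, Finset.sum_eq_zero, add_zero]
  · intro i _; rw [if_neg (h.not_inc_e hx i)]
  · intro k _; exact (hP.strand hO k).2.1.2.2 x hx

lemma Arranged.bd_glue_v {p : Piece} (hp : PieceDisjoint P p) (j : Fin 4) :
    bd I (glue P e p) (v j) = (pieceBd n p j : ℕ) := by
  rw [hP.bd_glue h hO hp, pieceBd, ZMod.natCast_mod, Nat.cast_add]
  congr 1
  · rw [Finset.natCast_card_filter]
    refine Finset.sum_congr rfl fun k _ => ?_
    rw [h.bd_v_outEven (hP.strand hO k).2.1, hP.ends]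
  · rw [Finset.natCast_card_filter]
    refine Finset.sum_congr rfl fun i _ => ?_
    simp only [h.inc_e, h.v_inj.eq_iff]

/-- Because the paths of the piece are disjoint, boundaries add up; outside the 4-cycle all terms
vanish, and at `v j` the sum is the symbolic parity. Circuits can thus be recognised from the
symbolic data. -/
lemma Arranged.isEven_glue {p : Piece} (hp : PieceDisjoint P p) :
    IsEven I (glue P e p) ↔ ∀ j, pieceBd n p j = 0 := by
  have key : ∀ j, bd I (glue P e p) (v j) = 0 ↔ pieceBd n p j = 0 := fun j => by
    rw [hP.bd_glue_v h hO hp, ZMod.natCast_eq_zero_iff]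
    have : pieceBd n p j < 2 := Nat.mod_lt _ (by norm_num)
    omega
  refine ⟨fun h' j => (key j).1 (h' _), fun h' x => ?_⟩
  by_cases hx : x ∈ Set.range v
  · obtain ⟨j, rfl⟩ := hx
    exact (key j).2 (h' j)
  · exact hP.bd_glue_out h hO hp hx

lemma Arranged.e_mem_glue {p : Piece} {i : Fin 4} : e i ∈ glue P e p ↔ i ∈ p.2 := by
  rw [mem_glue]
  constructor
  · rintro (⟨k, -, hk⟩ | ⟨j, hj, hji⟩)
    · exact absurd hk ((hP.strand hO k).2.1.2.1 i)
    · rwa [← h.e_inj hji]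
  · exact fun hi => Or.inr ⟨i, hi, rfl⟩

/-- A strand contained in a glued set is one of the paths it is glued from. -/
lemma Arranged.strand_subset_glue {p : Piece} (hp : PieceDisjoint P p) {F : Finset β}
    (hF : Strand I E v e F) (hsub : F ⊆ glue P e p) : ∃ k ∈ p.1, F = P k := by
  obtain ⟨g, hg⟩ := hF.1
  rcases mem_glue.1 (hsub hg) with ⟨k, hk, hgk⟩ | ⟨i, -, rfl⟩
  · refine ⟨k, hk, (h.strand_eq_or_disjoint hF (hP.strand hO k) hsub
      (Finset.subset_union_left.trans' (Finset.subset_biUnion_of_mem P hk))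
      fun x hx => hP.bd_glue_out h hO hp hx).resolve_right fun hd => ?_⟩
    exact Finset.disjoint_left.1 hd hg hgk
  · exact absurd hg (hF.2.1.2.1 i)

lemma Arranged.subset_glue_iff {p : Piece} (hp : PieceDisjoint P p) {k : Fin 4} :
    P k ⊆ glue P e p ↔ k ∈ p.1 := by
  constructor
  · intro hk
    obtain ⟨l, hl, hkl⟩ := hP.strand_subset_glue h hO hp (hP.strand hO k) hk
    rwa [hP.inj hkl]
  · exact fun hk => (Finset.subset_biUnion_of_mem P hk).trans Finset.subset_union_left

lemma Arranged.glue_inj {p q : Piece} (hp : PieceDisjoint P p) (hq : PieceDisjoint P q)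
    (hpq : glue P e p = glue P e q) : p = q := by
  refine Prod.ext (Finset.ext fun k => ?_) (Finset.ext fun i => ?_)
  · rw [← hP.subset_glue_iff h hO hp, hpq, hP.subset_glue_iff h hO hq]
  · rw [← hP.e_mem_glue h hO, hpq, hP.e_mem_glue h hO]

/-- An even subset contains or avoids each path entirely, so it is glued from a subpiece, and
minimality among subpieces carries over to edge sets. -/
lemma Arranged.isCirc_glue {p : Piece} (hp : PieceDisjoint P p) (hc : PieceCirc n p) :
    IsCirc I (glue P e p) := by
  refine ⟨?_, (hP.isEven_glue h hO hp).2 hc.2.1, fun F hF hne heven => ?_⟩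
  · rw [Finset.nonempty_iff_ne_empty]
    intro h0
    refine hc.1 (Prod.ext (Finset.eq_empty_of_forall_notMem fun k hk => ?_)
      (Finset.eq_empty_of_forall_notMem fun i hi => ?_))
    · have := (hP.subset_glue_iff h hO hp).2 hk
      rw [h0, Finset.subset_empty] at this
      exact (hP.strand hO k).1.ne_empty this
    · have := (hP.e_mem_glue h hO).2 hi
      simp [h0] at this
  · have hcase : ∀ k ∈ p.1, P k ⊆ F ∨ Disjoint (P k) F := fun k hk =>
      h.subset_or_disjoint (hP.strand hO k) ((hP.subset_glue_iff h hO hp).2 hk) hF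
        (fun x hx => hP.bd_glue_out h hO hp hx) fun x _ => heven x
    have hFq : F = glue P e (p.1.filter (P · ⊆ F), p.2.filter (e · ∈ F)) := by
      ext g
      rw [mem_glue]
      constructor
      · intro hg
        rcases mem_glue.1 (hF hg) with ⟨k, hk, hgk⟩ | ⟨i, hi, rfl⟩
        · refine Or.inl ⟨k, Finset.mem_filter.2 ⟨hk, (hcase k hk).resolve_right fun hd => ?_⟩, hgk⟩
          exact Finset.disjoint_left.1 hd hgk hg
        · exact Or.inr ⟨i, Finset.mem_filter.2 ⟨hi, hg⟩, rfl⟩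
      · rintro (⟨k, hk, hgk⟩ | ⟨i, hi, rfl⟩)
        · exact (Finset.mem_filter.1 hk).2 hgk
        · exact (Finset.mem_filter.1 hi).2
    have hd : PieceDisjoint P (p.1.filter (P · ⊆ F), p.2.filter (e · ∈ F)) :=
      Set.PairwiseDisjoint.subset hp (Finset.coe_subset.2 (Finset.filter_subset _ _))
    rcases hc.2.2 _ (Finset.mem_powerset.2 (Finset.filter_subset (P · ⊆ F) _)) _
      (Finset.mem_powerset.2 (Finset.filter_subset (e · ∈ F) _))
      ((hP.isEven_glue h hO hd).1 (hFq ▸ heven)) with h0 | h0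
    · rw [h0] at hFq
      simp [glue] at hFq
      exact absurd hFq hne.ne_empty
    · rw [hFq, h0]

end

/-- The double cover described by a list of pieces. -/
noncomputable def glueAll (f : Fin 4 → β) (O : Finset (Finset β)) (P : Fin 4 → Finset β)
    (e : Fin 4 → β) (X : Finset Piece) : Finset (Finset β) :=
  O.filter (endsOf f · = ∅) ∪ X.image (glue P e)

section
variable (h : Square I E v e f) (hO : StrandCover I E v e O) (hP : Arranged f O P n)
  (hn : ∀ k, (n k).Nonempty)
include h hO hP

lemma Arranged.glue_subset (p : Piece) : glue P e p ⊆ E := by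
  intro g hg
  rcases mem_glue.1 hg with ⟨k, -, hk⟩ | ⟨i, -, rfl⟩
  · exact (hP.strand hO k).2.1.1 hk
  · exact h.e_mem i

/-- Cutting the glued cover open returns the strands it was made from, which places it in the fibre
over `O`. -/
lemma Arranged.strands_glueAll {X : List Piece} (hX : PieceCover n X)
    (hd : ∀ p ∈ X, PieceDisjoint P p) : strands I E v e (glueAll f O P e X.toFinset) = O := by
  ext F
  rw [mem_strands]
  constructor
  · rintro ⟨hF, C, hC, hFC⟩
    rcases Finset.mem_union.1 hC with hC | hC
    · have hC := (Finset.mem_filter.1 hC).1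
      rwa [(hO.1 C hC).2.2 F hFC hF.1 hF.2.1]
    · obtain ⟨p, hp, rfl⟩ := Finset.mem_image.1 hC
      obtain ⟨k, -, rfl⟩ := hP.strand_subset_glue h hO (hd p (by simpa using hp)) hF hFC
      exact hP.mem k
  · intro hF
    refine ⟨hO.1 F hF, ?_⟩
    by_cases h0 : endsOf f F = ∅
    · exact ⟨F, Finset.mem_union_left _ (Finset.mem_filter.2 ⟨hF, h0⟩), subset_rfl⟩
    · obtain ⟨k, rfl⟩ := hP.exhaust F hF (Finset.nonempty_iff_ne_empty.2 h0)
      have : 0 < X.countP (k ∈ ·.1) := by rw [hX.2.2.1 k]; norm_num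
      obtain ⟨p, hp, hk⟩ := List.countP_pos_iff.1 this
      exact ⟨glue P e p, Finset.mem_union_right _ (Finset.mem_image_of_mem _ (by simpa using hp)),
        (hP.subset_glue_iff h hO (hd p hp)).2 (by simpa using hk)⟩

include hn

/-- A nonempty piece contributes some `f i` or `e i`, and closed strands contain neither. Hence the
two halves of `glueAll` are disjoint and their counts add. -/
lemma Arranged.glue_notMem {p : Piece} (hp0 : p ≠ (∅, ∅)) :
    glue P e p ∉ O.filter (endsOf f · = ∅) := by
  intro hm
  obtain ⟨hm, h0⟩ := Finset.mem_filter.1 hm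
  refine hp0 (Prod.ext (Finset.eq_empty_of_forall_notMem fun k hk => ?_)
    (Finset.eq_empty_of_forall_notMem fun i hi => ?_))
  · obtain ⟨i, hi⟩ := hn k
    rw [← hP.ends, mem_endsOf] at hi
    have : i ∈ endsOf f (glue P e p) := mem_endsOf.2 (mem_glue.2 (Or.inl ⟨k, hk, hi⟩))
    simp [h0] at this
  · exact (hO.1 _ hm).2.1.2.1 i ((hP.e_mem_glue h hO).2 hi)

lemma Arranged.glueAll_mem_covers {X : List Piece} (hX : PieceCover n X)
    (hd : ∀ p ∈ X, PieceDisjoint P p) : glueAll f O P e X.toFinset ∈ covers I E := by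
  have hinj : Set.InjOn (glue P e) (X.toFinset : Set Piece) := fun p hp q hq hpq =>
    hP.glue_inj h hO (hd p (by simpa using hp)) (hd q (by simpa using hq)) hpq
  rw [mem_covers]
  constructor
  · intro F hF
    rcases Finset.mem_union.1 hF with hF | hF
    · obtain ⟨hF, h0⟩ := Finset.mem_filter.1 hF
      have hs := hO.1 F hF
      refine ⟨hs.2.1.1, hs.1, h.isEven_of_outEven hs.2.1 h0, fun F' hF' hne hev =>
        hs.2.2 F' hF' hne ⟨hF'.trans hs.2.1.1, fun i hi => hs.2.1.2.1 i (hF' hi), fun x _ => hev x⟩⟩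
    · obtain ⟨p, hp, rfl⟩ := Finset.mem_image.1 hF
      rw [List.mem_toFinset] at hp
      exact ⟨hP.glue_subset h hO p, hP.isCirc_glue h hO (hd p hp) (hX.1 p hp)⟩
  · intro g hg
    have hdisj : Disjoint (O.filter (endsOf f · = ∅)) (X.toFinset.image (glue P e)) := by
      rw [Finset.disjoint_right]
      intro F hF
      obtain ⟨p, hp, rfl⟩ := Finset.mem_image.1 hF
      rw [List.mem_toFinset] at hp
      exact hP.glue_notMem h hO hn (hX.1 p hp).1
    have hcount : ∀ (q : Piece → Prop) [DecidablePred q],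
        (X.toFinset.filter q).card = X.countP (q ·) := by
      intro q _
      rw [List.countP_eq_length_filter, ← List.toFinset_card_of_nodup (hX.2.1.filter _)]
      congr 1; ext; simp
    rw [glueAll, Finset.filter_union, Finset.card_union_of_disjoint
      (Finset.disjoint_filter_filter hdisj), Finset.filter_image,
      Finset.card_image_of_injOn (hinj.mono (Finset.coe_subset.2 (Finset.filter_subset _ _)))]
    by_cases hge : ∃ i, g = e i
    · obtain ⟨i, rfl⟩ := hge
      have h1 : ((O.filter (endsOf f · = ∅)).filter (e i ∈ ·)).card = 0 := by
        rw [Finset.card_eq_zero, Finset.filter_eq_empty_iff]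
        intro F hF
        exact (hO.1 F (Finset.mem_filter.1 hF).1).2.1.2.1 i
      simp only [hP.e_mem_glue h hO]
      rw [h1, hcount, zero_add, hX.2.2.2 i]
    · push Not at hge
      -- The two strands through `g` are split into closed strands, which are members of the cover,
      -- and paths, each of which lies in exactly one piece.
      rw [← hO.2 g hg hge, ← Finset.card_filter_add_card_filter_not (s := O.filter (g ∈ ·))
        (endsOf f · = ∅), Finset.filter_filter, Finset.filter_filter, Finset.filter_filter]
      congr 1
      · congr 1; ext F; simp [and_comm]
      · have h1 : (O.filter fun F => g ∈ F ∧ ¬ endsOf f F = ∅) =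
            (Finset.univ.filter (g ∈ P ·)).image P := by
          ext F
          simp only [Finset.mem_filter, Finset.mem_image, Finset.mem_univ, true_and]
          constructor
          · rintro ⟨hF, hgF, hne⟩
            obtain ⟨k, rfl⟩ := hP.exhaust F hF (Finset.nonempty_iff_ne_empty.2 hne)
            exact ⟨k, hgF, rfl⟩
          · rintro ⟨k, hgk, rfl⟩
            exact ⟨hP.mem k, hgk, by rw [hP.ends]; exact (hn k).ne_empty⟩
        rw [h1, Finset.card_image_of_injective _ hP.inj]
        -- The paths of a piece are disjoint, so at most one of them contains `g`. Exchanging the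
        -- sums over pieces and paths then counts the paths through `g`.
        have h2 : ∀ p ∈ X.toFinset, (if g ∈ glue P e p then 1 else 0) =
            ∑ k, if g ∈ P k then (if k ∈ p.1 then 1 else 0) else 0 := by
          intro p hp
          rw [List.mem_toFinset] at hp
          by_cases hgp : g ∈ glue P e p
          · obtain ⟨k, hk, hgk⟩ := (mem_glue.1 hgp).resolve_right
              fun ⟨i, _, hi⟩ => hge i hi.symm
            rw [if_pos hgp, Finset.sum_eq_single k]
            · simp [hk, hgk]
            · intro l _ hlk
              by_cases hgl : g ∈ P l
              · rw [if_pos hgl, if_neg]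
                intro hl
                exact Finset.disjoint_left.1 (hd p hp hl hk hlk) hgl hgk
              · rw [if_neg hgl]
            · simp
          · rw [if_neg hgp, Finset.sum_eq_zero]
            intro k _
            by_cases hgk : g ∈ P k
            · rw [if_pos hgk, if_neg]
              exact fun hk => hgp (mem_glue.2 (Or.inl ⟨k, hk, hgk⟩))
            · rw [if_neg hgk]
        rw [Finset.card_filter, Finset.sum_congr rfl h2, Finset.sum_comm, Finset.card_filter]
        refine Finset.sum_congr rfl fun k _ => ?_
        by_cases hgk : g ∈ P k
        · simp only [if_pos hgk]
          rw [← Finset.card_filter, hcount, hX.2.2.1 k]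
        · simp [hgk]

lemma Arranged.glueAll_inj {X Y : Finset Piece} (hX : ∀ p ∈ X, p ≠ (∅, ∅))
    (hY : ∀ p ∈ Y, p ≠ (∅, ∅)) (hdX : ∀ p ∈ X, PieceDisjoint P p)
    (hdY : ∀ p ∈ Y, PieceDisjoint P p) (hXY : glueAll f O P e X = glueAll f O P e Y) : X = Y := by
  have key : ∀ X Y : Finset Piece, (∀ p ∈ X, p ≠ (∅, ∅)) → (∀ p ∈ X, PieceDisjoint P p) →
      (∀ p ∈ Y, PieceDisjoint P p) → glueAll f O P e X = glueAll f O P e Y → X ⊆ Y := by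
    intro X Y hX hdX hdY hXY p hp
    have hm : glue P e p ∈ glueAll f O P e Y := by
      rw [← hXY]; exact Finset.mem_union_right _ (Finset.mem_image_of_mem _ hp)
    obtain ⟨q, hq, hqp⟩ := Finset.mem_image.1
      ((Finset.mem_union.1 hm).resolve_left (hP.glue_notMem h hO hn (hX p hp)))
    rwa [← hP.glue_inj h hO (hdY q hq) (hdX p hp) hqp]
  exact (key X Y hX hdX hdY hXY).antisymm (key Y X hY hdY hdX hXY.symm)

end

end CycleSpace

end

/-! ### Covers avoiding two opposite edges, and the inequality for each family of strands -/

section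

open scoped Classical

namespace CycleSpace

/-- The edges of the 4-cycle in the circuit through an outer path with ends `m`, if only `e r` and
`e (r + 2)` are kept. -/
def keptEdges (r : Fin 4) (m : Finset (Fin 4)) : Finset (Fin 4) :=
  if m = {r, r + 1} then {r} else if m = {r + 2, r + 3} then {r + 2} else {r, r + 2}

lemma pieceBd_single {n : Fin 4 → Finset (Fin 4)} {k r : Fin 4} (hk : n k = {r, r + 1}) (j : Fin 4) :
    pieceBd n ({k}, {r}) j = 0 := by
  have : ∀ r j : Fin 4, ((if j ∈ ({r, r + 1} : Finset (Fin 4)) then 1 else 0) +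
      if j = r ∨ j = r + 1 then 1 else 0) % 2 = 0 := by decide
  rw [← this r j]
  simp only [pieceBd, Finset.card_filter, Finset.sum_singleton, hk]

lemma pieceBd_pair {n : Fin 4 → Finset (Fin 4)} {k l r : Fin 4} (hl : n l = (n k)ᶜ) (j : Fin 4) :
    pieceBd n ({k, l}, {r, r + 2}) j = 0 := by
  have hkl : k ≠ l := by
    rintro rfl
    have := congrArg (0 ∈ ·) hl
    simp at this
  have h1 : ∀ r j : Fin 4, (({r, r + 2} : Finset (Fin 4)).filter
      fun i => j = i ∨ j = i + 1).card = 1 := by decide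
  have h2 : (({k, l} : Finset (Fin 4)).filter (j ∈ n ·)).card = 1 := by
    rw [Finset.card_filter, Finset.sum_pair hkl, hl]
    by_cases hj : j ∈ n k <;> simp [hj]
  simp only [pieceBd]
  rw [h1, h2]

lemma fin4_mem_halves (r : Fin 4) (m : Finset (Fin 4)) (hm : m.card = 2) (h1 : m ≠ {r, r + 1})
    (h2 : m ≠ {r + 2, r + 3}) : (r ∈ m ∨ r + 1 ∈ m) ∧ (r + 2 ∈ m ∨ r + 3 ∈ m) := by
  revert r m; decide

lemma fin4_eq_or (r i : Fin 4) : i = r ∨ i = r + 1 ∨ i = r + 2 ∨ i = r + 3 := by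
  revert r i; decide

lemma fin4_compl_crossing (r : Fin 4) (m : Finset (Fin 4))
    (h : ¬ (m = {r, r + 1} ∨ m = {r + 2, r + 3})) :
    ¬ (mᶜ = {r, r + 1} ∨ mᶜ = {r + 2, r + 3}) := by
  revert r m; decide

variable {α β : Type*} {I : β → α → Prop} {E : Finset β} {v : Fin 4 → α} {e f : Fin 4 → β}
  {O D : Finset (Finset β)} {P : Fin 4 → Finset β} {n : Fin 4 → Finset (Fin 4)}

lemma outer_sdiff (i j : Fin 4) :
    Square.Outer E (E \ {e i, e j}) e :=
  ⟨Finset.sdiff_subset, fun g hg hge => by simp [hg, hge]⟩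

/-- At the 4-cycle, an even set without `e (r + 1)` and `e (r + 3)`. -/
lemma Square.f_mem_iff (h : Square I E v e f) {C : Finset β} (hC : IsEven I C) {r : Fin 4}
    (h1 : e (r + 1) ∉ C) (h3 : e (r + 3) ∉ C) : (f r ∈ C ↔ e r ∈ C) ∧ (f (r + 1) ∈ C ↔ e r ∈ C) ∧
      (f (r + 2) ∈ C ↔ e (r + 2) ∈ C) ∧ (f (r + 3) ∈ C ↔ e (r + 2) ∈ C) := by
  have key : ∀ i, ((e i ∈ C → (e (i - 1) ∈ C ↔ f i ∉ C)) ∧ (e i ∉ C → (e (i - 1) ∈ C ↔ f i ∈ C))) :=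
    fun i => (bd_star_eq_zero (h.e_ne_pred i) (h.e_ne_f _ _) (h.e_ne_f _ _) (h.star_v i)).1 (hC _)
  have e0 : ∀ r : Fin 4, r - 1 = r + 3 := by decide
  have e1 : ∀ r : Fin 4, r + 1 - 1 = r := by decide
  have e2 : ∀ r : Fin 4, r + 2 - 1 = r + 1 := by decide
  have e3 : ∀ r : Fin 4, r + 3 - 1 = r + 2 := by decide
  have k0 := key r
  have k1 := key (r + 1)
  have k2 := key (r + 2)
  have k3 := key (r + 3)
  rw [e0] at k0
  rw [e1] at k1
  rw [e2] at k2
  rw [e3] at k3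
  clear key e0 e1 e2 e3 hC h
  by_cases hr : e r ∈ C <;> by_cases hr' : e (r + 2) ∈ C <;> simp_all

/-- A kept edge `e r` is not adjacent to the other kept edge, so parity at its end forces the third
edge there into `C`. -/
lemma Square.exists_off_cycle (h : Square I E v e f) {C : Finset β} (hC : IsEven I C)
    (hne : C.Nonempty) {r : Fin 4} (h1 : e (r + 1) ∉ C) (h3 : e (r + 3) ∉ C) :
    ∃ g ∈ C, ∀ i, g ≠ e i := by
  have hf := h.f_mem_iff hC h1 h3
  obtain ⟨g, hg⟩ := hne
  by_cases hge : ∃ i, g = e i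
  · obtain ⟨i, rfl⟩ := hge
    rcases fin4_eq_or r i with rfl | rfl | rfl | rfl
    · exact ⟨_, hf.1.2 hg, fun j => (h.e_ne_f _ _).symm⟩
    · exact absurd hg h1
    · exact ⟨_, hf.2.2.1.2 hg, fun j => (h.e_ne_f _ _).symm⟩
    · exact absurd hg h3
  · exact ⟨g, hg, by simpa using hge⟩

lemma pieceDisjoint_single (k : Fin 4) (T : Finset (Fin 4)) : PieceDisjoint P ({k}, T) := by
  simp [PieceDisjoint]

lemma pieceDisjoint_pair {k l : Fin 4} (hkl : Disjoint (P k) (P l)) (T : Finset (Fin 4)) :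
    PieceDisjoint P ({k, l}, T) := by
  intro a ha b hb hab
  simp only [Finset.coe_insert, Finset.coe_singleton, Set.mem_insert_iff,
    Set.mem_singleton_iff] at ha hb
  rcases ha with rfl | rfl <;> rcases hb with rfl | rfl
  exacts [absurd rfl hab, hkl, hkl.symm, absurd rfl hab]

/-- The circuit of a cover of `G - {e (r + 1), e (r + 3)}` through an outer path contains at most
one other outer path. -/
lemma Arranged.exists_partner (h : Square I E v e f) {r : Fin 4}
    (hD : D ∈ covers I (E \ {e (r + 1), e (r + 3)})) (hP : Arranged f (strands I E v e D) P n)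
    (hn : ∀ k, (n k).card = 2) (k : Fin 4) :
    ∃ l, glue P e ({k, l}, keptEdges r (n k)) ∈ D ∧
      (l ≠ k → Disjoint (P k) (P l)) ∧
      if n k = {r, r + 1} ∨ n k = {r + 2, r + 3} then l = k else n l = (n k)ᶜ := by
  have hO := h.strandCover_strands (outer_sdiff (r + 1) (r + 3)) hD
  have hs := hP.strand hO k
  obtain ⟨C, hC, hkC⟩ := (mem_strands.1 (hP.mem k)).2
  obtain ⟨hCE, hcirc⟩ := (mem_covers.1 hD).1 C hC
  have hf := h.f_mem_iff (r := r) hcirc.2.1 (fun hc => by simpa using hCE hc)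
    (fun hc => by simpa using hCE hc)
  have hfk : ∀ i ∈ n k, f i ∈ C := fun i hi => by
    rw [← hP.ends, mem_endsOf] at hi; exact hkC hi
  -- Any balanced piece containing `k` and glued inside the circuit `C` is a nonempty even subset,
  -- hence all of `C`.
  have hglue : ∀ p : Piece, PieceDisjoint P p → k ∈ p.1 → (∀ j, pieceBd n p j = 0) →
      (∀ l ∈ p.1, P l ⊆ C) → (∀ i ∈ p.2, e i ∈ C) → glue P e p ∈ D := by
    intro p hp hk hb h1 h2
    have hsub : glue P e p ⊆ C := by
      intro g hg
      rcases mem_glue.1 hg with ⟨l, hl, hgl⟩ | ⟨i, hi, rfl⟩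
      exacts [h1 l hl hgl, h2 i hi]
    rw [hcirc.2.2 _ hsub (hs.1.mono ((hP.subset_glue_iff h hO hp).2 hk))
      ((hP.isEven_glue h hO hp).2 hb)]
    exact hC
  by_cases c1 : n k = {r, r + 1}
  · refine ⟨k, ?_, fun h' => absurd rfl h', by simp [c1]⟩
    have he : e r ∈ C := hf.1.1 (hfk r (by simp [c1]))
    simp only [keptEdges, c1, if_true, Finset.pair_eq_singleton]
    exact hglue _ (pieceDisjoint_single k _) (by simp) (pieceBd_single c1) (by simpa using hkC)
      (by simpa using he)
  by_cases c2 : n k = {r + 2, r + 3}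
  · refine ⟨k, ?_, fun h' => absurd rfl h', by simp [c2]⟩
    have he : e (r + 2) ∈ C := hf.2.2.1.1 (hfk (r + 2) (by simp [c2]))
    simp only [keptEdges, if_neg c1, if_pos c2, Finset.pair_eq_singleton]
    exact hglue _ (pieceDisjoint_single k _) (by simp)
      (pieceBd_single (by rw [c2, add_assoc]; rfl)) (by simpa using hkC) (by simpa using he)
  · obtain ⟨m1, m2⟩ := fin4_mem_halves r (n k) (hn k) c1 c2
    have he1 : e r ∈ C := m1.elim (fun hm => hf.1.1 (hfk _ hm)) fun hm => hf.2.1.1 (hfk _ hm)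
    have he2 : e (r + 2) ∈ C :=
      m2.elim (fun hm => hf.2.2.1.1 (hfk _ hm)) fun hm => hf.2.2.2.1 (hfk _ hm)
    have hall : ∀ i, f i ∈ C := by
      intro i
      rcases fin4_eq_or r i with rfl | rfl | rfl | rfl
      exacts [hf.1.2 he1, hf.2.1.2 he1, hf.2.2.1.2 he2, hf.2.2.2.2 he2]
    obtain ⟨i, hi⟩ : ((n k)ᶜ).Nonempty := by
      rw [← Finset.card_pos, Finset.card_compl, hn k]; decide
    have hfi : f i ∉ P k := by
      rw [← mem_endsOf, hP.ends]; exact Finset.mem_compl.1 hi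
    have hsubk : P k ⊆ C \ Finset.univ.image e := by
      intro g hg
      refine Finset.mem_sdiff.2 ⟨hkC hg, fun hg' => ?_⟩
      obtain ⟨j, -, rfl⟩ := Finset.mem_image.1 hg'
      exact hs.2.1.2.1 j hg
    have hout := Square.outEven_sdiff
      (h.outEven_of_isEven (hCE.trans Finset.sdiff_subset) hcirc.2.1) hs.2.1 hsubk
    -- A path meeting both halves forces both kept edges, and so all four third edges, into `C`. The
    -- strand of `C \ P k` at an unused `f i` is the partner; being disjoint from `P k`, it has the
    -- complementary ends.
    obtain ⟨F, hF, hFs, hfF⟩ := Square.exists_strand (g := f i) hout (by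
      simp only [Finset.mem_sdiff, hall i, hfi, true_and, not_false_eq_true, and_true,
        Finset.mem_image, Finset.mem_univ]
      rintro ⟨j, hj⟩
      exact h.e_ne_f _ _ hj)
    have hFC : F ⊆ C := hF.trans (Finset.sdiff_subset.trans Finset.sdiff_subset)
    obtain ⟨l, rfl⟩ := hP.exhaust F (mem_strands.2 ⟨hFs, C, hC, hFC⟩) ⟨i, mem_endsOf.2 hfF⟩
    have hdis : Disjoint (P k) (P l) := by
      rw [Finset.disjoint_right]
      exact fun g hg hg' => (Finset.mem_sdiff.1 (hF hg)).2 hg'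
    have hl : n l = (n k)ᶜ := by
      refine Finset.eq_of_subset_of_card_le (fun j hj => ?_) (by
        rw [Finset.card_compl, hn k, hn l]; rfl)
      rw [Finset.mem_compl]
      intro hj'
      rw [← hP.ends, mem_endsOf] at hj hj'
      exact Finset.disjoint_left.1 hdis hj' hj
    refine ⟨l, ?_, fun _ => hdis, by simp [c1, c2, hl]⟩
    simp only [keptEdges, if_neg c1, if_neg c2]
    refine hglue _ (pieceDisjoint_pair hdis _) (by simp) (pieceBd_pair hl) ?_ ?_
    · simp [hkC, hFC]
    · simp [he1, he2]

/-- The cover described by a joining. -/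
noncomputable def joinAll (f : Fin 4 → β) (O : Finset (Finset β)) (P : Fin 4 → Finset β)
    (e : Fin 4 → β) (n : Fin 4 → Finset (Fin 4)) (r : Fin 4) (π : Fin 4 → Fin 4) :
    Finset (Finset β) :=
  glueAll f O P e (Finset.univ.image fun k => ({k, π k}, keptEdges r (n k)))

/-- Every member leaves the 4-cycle and so contains a strand. A closed strand is the whole member; a
path determines it together with its partner. The strands and the pairing therefore recover the
cover. -/
lemma Arranged.exists_joining (h : Square I E v e f) {r : Fin 4}
    (hD : D ∈ covers I (E \ {e (r + 1), e (r + 3)})) (hP : Arranged f (strands I E v e D) P n)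
    (hn : ∀ k, (n k).card = 2) : ∃ π, Joining r n π ∧ (∀ k, π k ≠ k → Disjoint (P k) (P (π k))) ∧
      D = joinAll f (strands I E v e D) P e n r π := by
  have hE := outer_sdiff (E := E) (e := e) (r + 1) (r + 3)
  have hO := h.strandCover_strands hE hD
  choose π hmem hdis hπ using hP.exists_partner (r := r) h hD hn
  have hpd : ∀ k, PieceDisjoint P ({k, π k}, keptEdges r (n k)) := by
    intro k
    by_cases hk : π k = k
    · rw [hk, Finset.pair_eq_singleton]; exact pieceDisjoint_single _ _
    · exact pieceDisjoint_pair (hdis k hk) _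
  have hsub : ∀ k l, l = k ∨ l = π k → P l ⊆ glue P e ({k, π k}, keptEdges r (n k)) := fun k l hl =>
    (hP.subset_glue_iff h hO (hpd k)).2 (by simpa using hl)
  have huniq : ∀ k, ∀ C ∈ D, P k ⊆ C → C = glue P e ({k, π k}, keptEdges r (n k)) :=
    fun k C hC hkC => h.eq_of_strand_subset hE hD (hP.strand hO k) hC (hmem k) hkC
      (hsub k k (Or.inl rfl))
  refine ⟨π, ⟨fun k => ?_, hπ⟩, hdis, ?_⟩
  · by_cases hk : π k = k
    · rw [hk, hk]
    · have h1 := huniq (π k) _ (hmem k) (hsub k _ (Or.inr rfl))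
      have h2 : P (π (π k)) ⊆ glue P e ({k, π k}, keptEdges r (n k)) := by
        rw [h1]; exact hsub _ _ (Or.inr rfl)
      have h3 := (hP.subset_glue_iff h hO (hpd k)).1 h2
      simp only [Finset.mem_insert, Finset.mem_singleton] at h3
      -- Otherwise `π k` would be its own partner while crossing the halves, and its end set would
      -- equal its complement.
      refine h3.resolve_right fun h4 => ?_
      have hc : ¬ (n k = {r, r + 1} ∨ n k = {r + 2, r + 3}) := fun hc => by
        have := hπ k; rw [if_pos hc] at this; exact hk this
      have h5 := hπ k
      rw [if_neg hc] at h5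
      have h6 := hπ (π k)
      rw [h5, if_neg (fin4_compl_crossing r _ hc), h4, h5, compl_compl] at h6
      have := congrArg (0 ∈ ·) h6
      simp at this
  · ext C
    constructor
    · intro hC
      obtain ⟨hCE, hcirc⟩ := (mem_covers.1 hD).1 C hC
      obtain ⟨g, hg, hge⟩ := h.exists_off_cycle (r := r) hcirc.2.1 hcirc.1
        (fun hc => by simpa using hCE hc) (fun hc => by simpa using hCE hc)
      obtain ⟨F, hFC, hF, -⟩ := h.exists_strand_of_mem (hCE.trans hE.1) hcirc.2.1 hg hge
      have hFO := mem_strands.2 ⟨hF, C, hC, hFC⟩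
      by_cases h0 : endsOf f F = ∅
      · obtain rfl := hcirc.2.2 F hFC hF.1 (h.isEven_of_outEven hF.2.1 h0)
        exact Finset.mem_union_left _ (Finset.mem_filter.2 ⟨hFO, h0⟩)
      · obtain ⟨k, rfl⟩ := hP.exhaust F hFO (Finset.nonempty_iff_ne_empty.2 h0)
        rw [huniq k C hC hFC]
        exact Finset.mem_union_right _ (Finset.mem_image_of_mem _
          (Finset.mem_image_of_mem _ (Finset.mem_univ k)))
    · intro hC
      rcases Finset.mem_union.1 hC with hC | hC
      · obtain ⟨hC, h0⟩ := Finset.mem_filter.1 hC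
        obtain ⟨hF, C', hC', hsub⟩ := mem_strands.1 hC
        rwa [((mem_covers.1 hD).1 C' hC').2.2.2 C hsub hF.1 (h.isEven_of_outEven hF.2.1 h0)]
      · simp only [Finset.mem_image, Finset.mem_univ, true_and] at hC
        obtain ⟨p, ⟨k, rfl⟩, rfl⟩ := hC
        exact hmem k

lemma pattern_card (t : Fin 6) (k : Fin 4) : (pattern t k).card = 2 := by
  revert t k; decide

/-- The all-true table says that two indices lie in different halves {0, 1} and {2, 3}, so
`disjTable` records every disjointness that a joining can require. -/
lemma joiningsZero_cross (t : Fin 6) : ∀ π ∈ joiningsZero t, ∀ k, π k ≠ k →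
    table true true true true k (π k) = true := by
  revert t; decide +kernel

lemma joiningsOne_cross (t : Fin 6) : ∀ π ∈ joiningsOne t, ∀ k, π k ≠ k →
    table true true true true k (π k) = true := by
  revert t; decide +kernel

/-- The relation of being disjoint, for the four outer paths. -/
noncomputable def disjTable (P : Fin 4 → Finset β) : Fin 4 → Fin 4 → Bool :=
  table (decide (Disjoint (P 0) (P 2))) (decide (Disjoint (P 0) (P 3)))
    (decide (Disjoint (P 1) (P 2))) (decide (Disjoint (P 1) (P 3)))

lemma disjoint_of_disjTable {k l : Fin 4} (h : disjTable P k l = true) : Disjoint (P k) (P l) := by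
  fin_cases k <;> fin_cases l <;> simp [disjTable, table] at h <;>
    first | exact h | exact h.symm

lemma disjTable_of_disjoint {k l : Fin 4} (h : table true true true true k l = true)
    (hd : Disjoint (P k) (P l)) : disjTable P k l = true := by
  fin_cases k <;> fin_cases l <;> simp [disjTable, table] at h ⊢ <;>
    first | exact hd | exact hd.symm

lemma Arranged.card_fiber_le_joinings (h : Square I E v e f) (hP : Arranged f O P n) (r : Fin 4)
    (hn : ∀ k, (n k).card = 2) (L : List (Fin 4 → Fin 4)) (hL : ∀ π, Joining r n π → π ∈ L)
    (hcross : ∀ π ∈ L, ∀ k, π k ≠ k → table true true true true k (π k) = true) :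
    ((covers I (E \ {e (r + 1), e (r + 3)})).filter (strands I E v e · = O)).card ≤
      (L.filter (allowsJoining (disjTable P))).length := by
  have hsub : (covers I (E \ {e (r + 1), e (r + 3)})).filter (strands I E v e · = O) ⊆
      ((L.filter (allowsJoining (disjTable P))).map
        (joinAll f O P e n r)).toFinset := by
    intro D hD
    obtain ⟨hD', rfl⟩ := Finset.mem_filter.1 hD
    obtain ⟨π, hj, hdis, hDπ⟩ := hP.exists_joining (r := r) h hD' hn
    rw [List.mem_toFinset, List.mem_map]
    refine ⟨π, ?_, hDπ.symm⟩
    rw [List.mem_filter]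
    exact ⟨hL π hj, allowsJoining_iff.2 fun k hk =>
      disjTable_of_disjoint (hcross π (hL π hj) k hk) (hdis k hk)⟩
  refine (Finset.card_le_card hsub).trans ((List.toFinset_card_le _).trans ?_)
  rw [List.length_map]

/-- Each listed symbolic cover whose joined paths are disjoint glues to a cover with strands `O`;
different sets of pieces give different covers. -/
lemma Arranged.length_le_card_fiber (h : Square I E v e f) (hO : StrandCover I E v e O)
    (hP : Arranged f O P n) (hn : ∀ k, (n k).Nonempty)
    (L : List (List Piece × List (Fin 4 × Fin 4))) (hnd : (L.map fun X => X.1.toFinset).Nodup)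
    (hcov : ∀ X ∈ L, PieceCover n X.1) (hjoin : ∀ X ∈ L, ∀ p ∈ X.1, JoinedBy X.2 p) :
    (L.filter fun X => allowsPairs (disjTable P) X.2).length ≤
      ((covers I E).filter (strands I E v e · = O)).card := by
  have hmem : ∀ X ∈ L.filter fun X => allowsPairs (disjTable P) X.2,
      X ∈ L ∧ ∀ p ∈ X.1, PieceDisjoint P p := by
    intro X hX
    rw [List.mem_filter] at hX
    refine ⟨hX.1, fun p hp k hk l hl hkl => ?_⟩
    rcases hjoin X hX.1 p hp k hk l hl hkl with hq | hq
    · exact disjoint_of_disjTable (allowsPairs_iff.1 hX.2 _ hq)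
    · exact (disjoint_of_disjTable (allowsPairs_iff.1 hX.2 _ hq)).symm
  replace hnd : ((L.filter fun X => allowsPairs (disjTable P) X.2).map
      fun X => X.1.toFinset).Nodup := hnd.sublist (List.Sublist.map _ List.filter_sublist)
  generalize (L.filter fun X => allowsPairs (disjTable P) X.2) = K at hmem hnd
  have hnd' : ((K.map fun X => X.1.toFinset).map (glueAll f O P e)).Nodup := by
    refine hnd.map_on fun X hX Y hY hXY => ?_
    obtain ⟨X, hX', rfl⟩ := List.mem_map.1 hX
    obtain ⟨Y, hY', rfl⟩ := List.mem_map.1 hY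
    obtain ⟨hX, hdX⟩ := hmem X hX'
    obtain ⟨hY, hdY⟩ := hmem Y hY'
    exact hP.glueAll_inj h hO hn
      (fun p hp => ((hcov X hX).1 p (List.mem_toFinset.1 hp)).1)
      (fun p hp => ((hcov Y hY).1 p (List.mem_toFinset.1 hp)).1)
      (fun p hp => hdX p (List.mem_toFinset.1 hp))
      (fun p hp => hdY p (List.mem_toFinset.1 hp)) hXY
  have hlen : K.length = ((K.map fun X => X.1.toFinset).map (glueAll f O P e)).length := by simp
  rw [hlen, ← List.toFinset_card_of_nodup hnd']
  refine Finset.card_le_card fun D hD => ?_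
  rw [List.mem_toFinset, List.map_map] at hD
  obtain ⟨X, hX, rfl⟩ := List.mem_map.1 hD
  obtain ⟨hX, hdX⟩ := hmem X hX
  exact Finset.mem_filter.2 ⟨hP.glueAll_mem_covers h hO hn (hcov X hX) hdX,
    hP.strands_glueAll h hO (hcov X hX) hdX⟩

/-- For each family `O` of strands, the covers with these strands. -/
lemma Square.card_fiber_le (h : Square I E v e f) (O : Finset (Finset β)) :
    2 * ((covers I (E \ {e 0, e 2})).filter (strands I E v e · = O)).card +
      2 * ((covers I (E \ {e 1, e 3})).filter (strands I E v e · = O)).card ≤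
      ((covers I E).filter (strands I E v e · = O)).card := by
  -- The parameter `r` names the kept edges, so deleting `e 0` and `e 2` is the case `r = 1`, with 1
  -- + 3 = 0 in `Fin 4`.
  have e02 : E \ {e 0, e 2} = E \ {e (1 + 1), e (1 + 3)} := by
    rw [Finset.pair_comm]; rfl
  have e13 : E \ {e 1, e 3} = E \ {e (0 + 1), e (0 + 3)} := rfl
  by_cases hO : StrandCover I E v e O
  swap
  · rw [Finset.filter_false_of_mem, Finset.filter_false_of_mem]
    · simp
    · rintro D hD rfl; exact hO (h.strandCover_strands (outer_sdiff 1 3) hD)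
    · rintro D hD rfl; exact hO (h.strandCover_strands (outer_sdiff 0 2) hD)
  obtain ⟨t, P, hP⟩ := h.exists_arranged hO
  have hn := pattern_card t
  have hn' : ∀ k, (pattern t k).Nonempty := fun k => Finset.card_pos.1 (by rw [hn k]; norm_num)
  have u1 := hP.card_fiber_le_joinings h 1 hn _ (joining_one t) (joiningsOne_cross t)
  have u0 := hP.card_fiber_le_joinings h 0 hn _ (joining_zero t) (joiningsZero_cross t)
  have lower := hP.length_le_card_fiber h hO hn' _ (patternCovers_nodup t) (pieceCover_of_mem t)
    (patternCovers_joinedBy t)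
  rw [← e02] at u1
  rw [← e13] at u0
  have := length_joinings_le t (decide (Disjoint (P 0) (P 2))) (decide (Disjoint (P 0) (P 3)))
    (decide (Disjoint (P 1) (P 2))) (decide (Disjoint (P 1) (P 3)))
  simp only [disjTable] at u1 u0 lower
  omega

/-- Counting circuit double covers at a chordless 4-cycle of a cubic graph. -/
theorem Square.card_covers_le (h : Square I E v e f) :
    2 * (covers I (E \ {e 0, e 2})).card + 2 * (covers I (E \ {e 1, e 3})).card ≤
      (covers I E).card := by
  have key : ∀ E', (covers I E').card = ∑ O ∈ E.powerset.powerset,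
      ((covers I E').filter (strands I E v e · = O)).card := fun E' =>
    Finset.card_eq_sum_card_fiberwise fun D _ =>
      Finset.mem_coe.2 (Finset.mem_powerset.2 (Finset.filter_subset
        (fun F => Strand I E v e F ∧ ∃ C ∈ D, F ⊆ C) _))
  rw [key, key, key, Finset.mul_sum, Finset.mul_sum, ← Finset.sum_add_distrib]
  exact Finset.sum_le_sum fun O _ => h.card_fiber_le O

end CycleSpace

end

/-! ### From circuits to minimal even sets, and undoing suppressions -/

section

open scoped Classical

namespace CycleSpace

variable {α β : Type*} {I J : β → α → Prop} {F : Finset β} {x : α}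

lemma bd_two {a b : β} (hab : a ≠ b) (hx : ∀ g ∈ F, I g x ↔ g = a ∨ g = b) :
    bd I F x = (if a ∈ F then 1 else 0) + (if b ∈ F then 1 else 0) := by
  have h : ∀ g ∈ F, (if I g x then (1 : ZMod 2) else 0) =
      (if g = a then 1 else 0) + (if g = b then 1 else 0) := by
    intro g hg
    rw [if_congr (hx g hg) rfl rfl]
    by_cases h1 : g = a
    · subst h1; simp [hab]
    simp [h1]
  rw [bd, Finset.sum_congr rfl h, Finset.sum_add_distrib, Finset.sum_ite_eq', Finset.sum_ite_eq']

lemma isEven_congr (h : ∀ g ∈ F, ∀ x, I g x ↔ J g x) : IsEven I F ↔ IsEven J F :=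
  forall_congr' fun x => by rw [bd_congr fun g hg => h g hg x]

lemma isCirc_congr (h : ∀ g ∈ F, ∀ x, I g x ↔ J g x) : IsCirc I F ↔ IsCirc J F := by
  unfold IsCirc
  rw [isEven_congr h]
  refine and_congr_right fun _ => and_congr_right fun _ => forall_congr' fun F' =>
    forall_congr' fun hF' => forall_congr' fun _ => ?_
  rw [isEven_congr fun g hg => h g (hF' hg)]

/-- Circuit double covers of an edge set, as multisets of edge sets. -/
def MultiCover (I : β → α → Prop) (E : Set β) (D : Multiset (Finset β)) : Prop :=
  (∀ F ∈ D, ↑F ⊆ E ∧ IsCirc I F) ∧ ∀ g ∈ E, D.countP (g ∈ ·) = 2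

end CycleSpace

namespace Graph

open CycleSpace

variable {α β : Type*} {G H H' C C' : Graph α β} {x y : α} {g : β}

lemma deg_eq (G : Graph α β) (x : α) :
    G.deg x = {g | G.IsNonloopAt g x}.encard + 2 * (G.loopSet x).encard := by
  have h1 : G.incidenceSet x = {g | G.IsNonloopAt g x} ∪ G.loopSet x := by
    ext g
    simp only [mem_incidenceSet, Set.mem_union, Set.mem_ofPred_eq, mem_loopSet]
    exact ⟨fun h => h.isLoopAt_or_isNonloopAt.symm, fun h => h.elim IsNonloopAt.inc IsLoopAt.inc⟩
  have h2 : Disjoint {g | G.IsNonloopAt g x} (G.loopSet x) :=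
    Set.disjoint_left.2 fun g hg hg' => hg.not_isLoopAt x hg'
  rw [deg, h1, Set.encard_union_eq h2, add_assoc, two_mul]

lemma finite_incidenceSet (h : G.deg x ≠ ⊤) : (G.incidenceSet x).Finite := by
  rw [← Set.encard_ne_top_iff]
  intro h'
  exact h (by rw [deg, h', top_add])

lemma finite_edgeSet (hV : G.vertexSet.Finite) (h : ∀ x ∈ G.vertexSet, G.deg x ≠ ⊤) :
    G.edgeSet.Finite := by
  refine (hV.biUnion fun x hx => finite_incidenceSet (h x hx)).subset fun g hg => ?_
  obtain ⟨x, y, hxy⟩ := exists_isLink_of_mem_edgeSet hg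
  exact Set.mem_biUnion hxy.left_mem hxy.inc_left

/-- Degrees as natural numbers. -/
lemma deg_nat {n : ℕ} (h : G.deg x = n) :
    {g | G.IsNonloopAt g x}.Finite ∧ (G.loopSet x).Finite ∧
      {g | G.IsNonloopAt g x}.ncard + 2 * (G.loopSet x).ncard = n := by
  have hf := finite_incidenceSet (x := x) (G := G) (by rw [h]; exact ENat.natCast_ne_top n)
  have h1 : {g | G.IsNonloopAt g x}.Finite := hf.subset fun g hg => hg.inc
  have h2 : (G.loopSet x).Finite := hf.subset (loopSet_subset_incidenceSet x)
  refine ⟨h1, h2, ?_⟩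
  rw [deg_eq, ← h1.cast_ncard_eq, ← h2.cast_ncard_eq] at h
  exact_mod_cast h

/-- The local structure at a vertex of degree two. -/
lemma deg_two (h : G.deg x = 2) :
    (∃ a b, a ≠ b ∧ (∀ g, G.Inc g x ↔ g = a ∨ g = b) ∧ ∀ g, G.IsNonloopAt g x ↔ g = a ∨ g = b) ∨
      ∃ a, (∀ g, G.Inc g x ↔ g = a) ∧ ∀ g, ¬ G.IsNonloopAt g x := by
  obtain ⟨h1, h2, h3⟩ := deg_nat (n := 2) h
  have hinc : ∀ g, G.Inc g x ↔ g ∈ {g | G.IsNonloopAt g x} ∨ g ∈ G.loopSet x := fun g =>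
    ⟨fun h => h.isLoopAt_or_isNonloopAt.symm, fun h => h.elim IsNonloopAt.inc IsLoopAt.inc⟩
  have : (G.loopSet x).ncard = 0 ∨ (G.loopSet x).ncard = 1 := by omega
  rcases this with h0 | h0
  · obtain ⟨a, b, hab, hs⟩ := Set.ncard_eq_two.1 (show {g | G.IsNonloopAt g x}.ncard = 2 by omega)
    rw [Set.ncard_eq_zero h2] at h0
    refine Or.inl ⟨a, b, hab, fun g => ?_, fun g => ?_⟩
    · rw [hinc, hs, h0]; simp
    · change g ∈ {g | G.IsNonloopAt g x} ↔ _
      rw [hs]; simp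
  · obtain ⟨a, ha⟩ := Set.ncard_eq_one.1 h0
    have hs : {g | G.IsNonloopAt g x} = ∅ := (Set.ncard_eq_zero h1).1 (by omega)
    refine Or.inr ⟨a, fun g => ?_, fun g hg => ?_⟩
    · rw [hinc, hs, ha]; simp
    · have : g ∈ {g | G.IsNonloopAt g x} := hg
      simp [hs] at this

/-- The finite set of the edges of a graph (`∅` if there are infinitely many). -/
noncomputable def edgeFinset (C : Graph α β) : Finset β :=
  if h : C.edgeSet.Finite then h.toFinset else ∅

lemma mem_edgeFinset (h : C.edgeSet.Finite) : g ∈ C.edgeFinset ↔ g ∈ C.edgeSet := by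
  simp [edgeFinset, h]

lemma IsCircuit.finite_edgeSet (h : C.IsCircuit) : C.edgeSet.Finite :=
  Graph.finite_edgeSet h.1 fun x hx => by rw [h.2.2 x hx]; exact ENat.natCast_ne_top 2

lemma IsCircuit.exists_inc (h : C.IsCircuit) (hx : x ∈ C.vertexSet) : ∃ g, C.Inc g x := by
  rcases deg_two (h.2.2 x hx) with ⟨a, b, -, hab, -⟩ | ⟨a, ha, -⟩
  · exact ⟨a, (hab a).2 (Or.inl rfl)⟩
  · exact ⟨a, (ha a).2 rfl⟩

/-- By 2-regularity an even subset with one edge of `C` at a vertex has all of them there, and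
connectedness spreads this over `C`. A vertex carrying a loop has no other edge of `C`. -/
lemma IsCircuit.isCirc (h : C.IsCircuit) (hCH : C ≤ H) : IsCirc H.IsNonloopAt C.edgeFinset := by
  have hfin := h.finite_edgeSet
  have hm : ∀ g, g ∈ C.edgeFinset ↔ g ∈ C.edgeSet := fun g => mem_edgeFinset hfin
  have hnl : ∀ g ∈ C.edgeFinset, ∀ x, H.IsNonloopAt g x ↔ C.IsNonloopAt g x := fun g hg x =>
    (hCH.isNonloopAt_congr ((hm g).1 hg)).symm
  rw [isCirc_congr hnl]
  refine ⟨?_, fun x => ?_, fun F' hF' hne hev => ?_⟩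
  · obtain ⟨x, hx⟩ := h.2.1.1
    obtain ⟨g, hg⟩ := h.exists_inc hx
    exact ⟨g, (hm g).2 hg.edge_mem⟩
  · by_cases hx : x ∈ C.vertexSet
    · rcases deg_two (h.2.2 x hx) with ⟨a, b, hab, hi, hn⟩ | ⟨a, -, hn⟩
      · rw [bd_two hab fun g _ => hn g, if_pos ((hm a).2 ((hn a).2 (Or.inl rfl)).edge_mem),
          if_pos ((hm b).2 ((hn b).2 (Or.inr rfl)).edge_mem)]
        decide
      · exact bd_isolated hn
    · exact bd_isolated fun g hg => hx hg.vertex_mem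
  · have hloc : ∀ x, (∃ g ∈ F', C.Inc g x) → ∀ g, C.Inc g x → g ∈ F' := by
      rintro x ⟨g, hg, hgx⟩ g' hg'
      rcases deg_two (h.2.2 x hgx.vertex_mem) with ⟨a, b, hab, hi, hn⟩ | ⟨a, hi, hn⟩
      · have := hev x
        rw [bd_two hab fun g _ => hn g] at this
        have key : a ∈ F' ∧ b ∈ F' := by
          rcases (hi g).1 hgx with rfl | rfl
          · by_cases hb : b ∈ F'
            · exact ⟨hg, hb⟩
            · simp [hg, hb] at this
          · by_cases ha : a ∈ F'
            · exact ⟨ha, hg⟩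
            · simp [hg, ha] at this
        rcases (hi g').1 hg' with rfl | rfl
        exacts [key.1, key.2]
      · rwa [(hi g').1 hg', ← (hi g).1 hgx]
    obtain ⟨g0, hg0⟩ := hne
    obtain ⟨x0, y0, hxy⟩ := exists_isLink_of_mem_edgeSet ((hm g0).1 (hF' hg0))
    have hreach : ∀ y, Relation.ReflTransGen C.Adj x0 y → ∃ g ∈ F', C.Inc g y := by
      intro y hy
      induction hy with
      | refl => exact ⟨g0, hg0, hxy.inc_left⟩
      | tail _ hyz ih =>
        obtain ⟨k, hk⟩ := hyz
        exact ⟨k, hloc _ ih k hk.inc_left, hk.inc_right⟩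
    refine hF'.antisymm fun g hg => ?_
    obtain ⟨x, y, hgxy⟩ := exists_isLink_of_mem_edgeSet ((hm g).1 hg)
    exact hloc x (hreach x (h.2.1.2 x0 hxy.left_mem x hgxy.left_mem)) g hgxy.inc_left

/-- Circuits have no isolated vertices, so within a common supergraph the edges determine the
vertices. -/
lemma IsCircuit.eq_of_edgeFinset_eq (h : C.IsCircuit) (h' : C'.IsCircuit) (hC : C ≤ H)
    (hC' : C' ≤ H) (heq : C.edgeFinset = C'.edgeFinset) : C = C' := by
  have hE : C.edgeSet = C'.edgeSet := by
    ext g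
    rw [← mem_edgeFinset h.finite_edgeSet, heq, mem_edgeFinset h'.finite_edgeSet]
  have hcomp := Compatible.of_le_le hC hC'
  have key : ∀ {C C' : Graph α β}, C.IsCircuit → C.edgeSet = C'.edgeSet → C.Compatible C' →
      C.vertexSet ⊆ C'.vertexSet := by
    intro C C' h hE hc x hx
    obtain ⟨g, hg⟩ := h.exists_inc hx
    exact (hg.of_compatible hc (hE ▸ hg.edge_mem)).vertex_mem
  exact hcomp.ext ((key h hE hcomp).antisymm (key h' hE.symm hcomp.symm)) hE

lemma nu_le_encard_multiCover (H : Graph α β) :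
    H.nu ≤ {D | MultiCover H.IsNonloopAt H.edgeSet D}.encard := by
  have hinj : Set.InjOn edgeFinset {C : Graph α β | C ≤ H ∧ C.IsCircuit} :=
    fun C hC C' hC' heq => hC.2.eq_of_edgeFinset_eq hC'.2 hC.1 hC'.1 heq
  have hnonempty : Nonempty (Graph α β) := ⟨H⟩
  refine Set.encard_le_encard_of_injOn (f := Multiset.map edgeFinset) ?_ ?_
  · rintro 𝒞 ⟨h1, h2⟩
    refine ⟨fun F hF => ?_, fun g hg => ?_⟩
    · obtain ⟨C, hC, rfl⟩ := Multiset.mem_map.1 hF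
      obtain ⟨hCH, hcirc⟩ := h1 C hC
      exact ⟨fun g hg => hCH.edgeSet_mono ((mem_edgeFinset hcirc.finite_edgeSet).1 hg),
        hcirc.isCirc hCH⟩
    · rw [Multiset.countP_map, ← h2 g hg, Multiset.countP_eq_card_filter]
      congr 1
      exact Multiset.filter_congr fun C hC => mem_edgeFinset (h1 C hC).2.finite_edgeSet
  · intro 𝒞 h𝒞 𝒞' h𝒞' heq
    have key : ∀ 𝒞, H.IsCircuitDoubleCover 𝒞 → (𝒞.map edgeFinset).map
        (Function.invFunOn edgeFinset {C : Graph α β | C ≤ H ∧ C.IsCircuit}) = 𝒞 := by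
      intro 𝒞 h
      rw [Multiset.map_map]
      conv_rhs => rw [← Multiset.map_id 𝒞]
      exact Multiset.map_congr rfl fun C hC => hinj.leftInvOn_invFunOn (h.1 C hC)
    rw [← key 𝒞 h𝒞, heq, key 𝒞' h𝒞']

/-- Subdividing the new edge adds `f` to every member containing `e`. Erasing `f` inverts this, so
distinct covers stay distinct. -/
lemma encard_multiCover_le_of_suppressStep (h : SuppressStep H H') :
    {D | MultiCover H'.IsNonloopAt H'.edgeSet D}.encard ≤
      {D | MultiCover H.IsNonloopAt H.edgeSet D}.encard := by
  obtain ⟨v, x, y, e, f, hdeg, hef, hev, hfv, -, hlink⟩ := h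
  obtain ⟨a, b, hab, hinc, hnl⟩ | ⟨a, ha, -⟩ := deg_two hdeg
  swap
  · exact absurd (((ha e).1 hev.inc_left).trans ((ha f).1 hfv.inc_left).symm) hef
  have hset : ∀ g, (g = a ∨ g = b) ↔ g = e ∨ g = f := by
    have h1 := (hinc e).1 hev.inc_left
    have h2 := (hinc f).1 hfv.inc_left
    grind
  have hnlv : ∀ g, H.IsNonloopAt g v ↔ g = e ∨ g = f := fun g => by rw [hnl, hset]
  have hxv : v ≠ x := by
    rintro rfl
    exact ((hnlv e).2 (Or.inl rfl)).not_isLoopAt _ hev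
  have hyv : v ≠ y := by
    rintro rfl
    exact ((hnlv f).2 (Or.inr rfl)).not_isLoopAt _ hfv
  have hne : ∀ z, H.IsNonloopAt e z ↔ z = v ∨ z = x := by
    intro z
    constructor
    · exact fun hz => hz.inc.eq_or_eq_of_isLink hev
    · rintro (rfl | rfl)
      exacts [⟨x, hxv.symm, hev⟩, ⟨v, hxv, hev.symm⟩]
  have hnf : ∀ z, H.IsNonloopAt f z ↔ z = v ∨ z = y := by
    intro z
    constructor
    · exact fun hz => hz.inc.eq_or_eq_of_isLink hfv
    · rintro (rfl | rfl)
      exacts [⟨y, hyv.symm, hfv⟩, ⟨v, hyv, hfv.symm⟩]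
  have hne' : ∀ z, H'.IsNonloopAt e z ↔ x ≠ y ∧ (z = x ∨ z = y) := by
    intro z
    simp only [IsNonloopAt, hlink]
    constructor
    · rintro ⟨w, hw, ⟨-, ⟨rfl, rfl⟩ | ⟨rfl, rfl⟩⟩ | ⟨hc, -⟩⟩
      exacts [⟨hw.symm, Or.inl rfl⟩, ⟨hw, Or.inr rfl⟩, absurd rfl hc]
    · rintro ⟨hxy, rfl | rfl⟩
      · exact ⟨y, hxy.symm, Or.inl ⟨trivial, Or.inl ⟨rfl, rfl⟩⟩⟩
      · exact ⟨x, hxy, Or.inl ⟨trivial, Or.inr ⟨rfl, rfl⟩⟩⟩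
  have hother : ∀ g, g ≠ e → g ≠ f → ∀ z, H'.IsNonloopAt g z ↔ H.IsNonloopAt g z := by
    intro g h1 h2 z
    simp only [IsNonloopAt, hlink]
    simp [h1, h2]
  have hmem : ∀ g, g ∈ H'.edgeSet ↔ g ∈ H.edgeSet ∧ g ≠ f := by
    intro g
    rw [edge_mem_iff_exists_isLink]
    simp only [hlink]
    constructor
    · rintro ⟨p, q, ⟨rfl, -⟩ | ⟨-, h2, h3⟩⟩
      exacts [⟨hev.edge_mem, hef⟩, ⟨h3.edge_mem, h2⟩]
    · rintro ⟨h1, h2⟩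
      by_cases hg : g = e
      · exact ⟨x, y, Or.inl ⟨hg, Or.inl ⟨rfl, rfl⟩⟩⟩
      · obtain ⟨p, q, hpq⟩ := exists_isLink_of_mem_edgeSet h1
        exact ⟨p, q, Or.inr ⟨hg, h2, hpq⟩⟩
  let φ : Finset β → Finset β := fun F => if e ∈ F then insert f F else F
  -- At `v` the contributions of `e` and `f` cancel; elsewhere they add up to that of the new edge.
  -- If `x = y` they cancel there too, matching the zero boundary of a loop.
  have hbd : ∀ F, f ∉ F → ∀ z, bd H.IsNonloopAt (φ F) z = bd H'.IsNonloopAt F z := by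
    intro F hf z
    by_cases he : e ∈ F
    · have h0 : bd H.IsNonloopAt (F.erase e) z = bd H'.IsNonloopAt (F.erase e) z :=
        bd_congr fun g hg => (hother g (Finset.ne_of_mem_erase hg)
          (fun h => hf (h ▸ Finset.mem_of_mem_erase hg)) z).symm
      have hs : ∀ K : Graph α β, bd K.IsNonloopAt F z =
          (if K.IsNonloopAt e z then 1 else 0) + bd K.IsNonloopAt (F.erase e) z := fun K => by
        conv_lhs => rw [← Finset.insert_erase he]
        rw [Finset.insert_eq, bd_union (by simp), bd_singleton]
      simp only [φ, if_pos he]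
      rw [Finset.insert_eq, bd_union (by simpa using hf), bd_singleton, hs, hs, h0, ← add_assoc]
      congr 1
      rw [if_congr (hnf z) rfl rfl, if_congr (hne z) rfl rfl, if_congr (hne' z) rfl rfl]
      by_cases h1 : z = v
      · subst h1
        simp [hxv, hyv]
        decide
      · by_cases h2 : z = x <;> by_cases h3 : z = y
        · subst h2; subst h3; simp; decide
        · subst h2; simp [h1, h3]
        · subst h3; simp [h1, h2]; exact fun h => h2 h.symm
        · simp [h1, h2, h3]
    · simp only [φ, if_neg he]
      exact bd_congr fun g hg => (hother g (fun h => he (h ▸ hg)) (fun h => hf (h ▸ hg)) z).symm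
  -- Evenness at `v` means that `F` contains both or neither of `e` and `f`; hence even subsets of
  -- `φ F` come from `H'`, which yields minimality.
  have hφ : ∀ F, IsEven H.IsNonloopAt F → φ (F.erase f) = F := by
    intro F hF
    have := hF v
    rw [bd_two hef fun g _ => hnlv g] at this
    by_cases he : e ∈ F <;> by_cases hf : f ∈ F <;> simp [he, hf] at this
    · simp [φ, he, hef, Finset.insert_erase hf]
    · simp [φ, he, Finset.erase_eq_of_notMem hf]
  have hmemφ : ∀ F g, g ≠ f → (g ∈ φ F ↔ g ∈ F) := by
    intro F g hg
    by_cases he : e ∈ F <;> simp [φ, he, hg]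
  have hφf : ∀ F, f ∉ F → (f ∈ φ F ↔ e ∈ F) := by
    intro F hF
    by_cases he : e ∈ F <;> simp [φ, he, hF]
  have herase : ∀ F, f ∉ F → (φ F).erase f = F := by
    intro F hF
    by_cases he : e ∈ F <;> simp [φ, he, hF]
  have hcirc : ∀ F, f ∉ F → IsCirc H'.IsNonloopAt F → IsCirc H.IsNonloopAt (φ F) := by
    rintro F hf ⟨hne, hev, hmin⟩
    refine ⟨?_, fun z => by rw [hbd F hf]; exact hev z, fun K hK hKne hKev => ?_⟩
    · obtain ⟨g, hg⟩ := hne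
      exact ⟨g, (hmemφ F g fun h => hf (h ▸ hg)).2 hg⟩
    · rw [← hφ K hKev]
      congr 1
      refine hmin _ (fun g hg => ?_) ?_ fun z => ?_
      · exact (hmemφ F g (Finset.ne_of_mem_erase hg)).1 (hK (Finset.mem_of_mem_erase hg))
      · rw [Finset.nonempty_iff_ne_empty]
        intro h0
        have := hφ K hKev
        rw [h0] at this
        simp only [φ, Finset.notMem_empty, if_false] at this
        exact hKne.ne_empty this.symm
      · rw [← hbd _ (by simp), hφ K hKev]; exact hKev z
  have hnotf : ∀ D, MultiCover H'.IsNonloopAt H'.edgeSet D → ∀ F ∈ D, f ∉ F := fun D hD F hF hf =>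
    ((hmem f).1 ((hD.1 F hF).1 hf)).2 rfl
  refine Set.encard_le_encard_of_injOn (f := Multiset.map φ) ?_ ?_
  · intro D hD
    have hf := hnotf D hD
    refine ⟨fun K hK => ?_, fun g hg => ?_⟩
    · obtain ⟨F, hF, rfl⟩ := Multiset.mem_map.1 hK
      refine ⟨fun g hg => ?_, hcirc F (hf F hF) (hD.1 F hF).2⟩
      by_cases hgf : g = f
      · rw [hgf]; exact hfv.edge_mem
      · exact ((hmem g).1 ((hD.1 F hF).1 ((hmemφ F g hgf).1 hg))).1
    · rw [Multiset.countP_map, ← Multiset.countP_eq_card_filter]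
      by_cases hgf : g = f
      · subst hgf
        rw [← hD.2 e ((hmem e).2 ⟨hev.edge_mem, hef⟩)]
        exact Multiset.countP_congr rfl fun F hF => by simpa using hφf F (hf F hF)
      · rw [← hD.2 g ((hmem g).2 ⟨hg, hgf⟩)]
        exact Multiset.countP_congr rfl fun F hF => by simpa using hmemφ F g hgf
  · intro D hD D' hD' heq
    have key : ∀ D, MultiCover H'.IsNonloopAt H'.edgeSet D →
        (D.map φ).map (·.erase f) = D := by
      intro D hD
      rw [Multiset.map_map]
      conv_rhs => rw [← Multiset.map_id D]
      exact Multiset.map_congr rfl fun F hF => herase F (hnotf D hD F hF)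
    rw [← key D hD, heq, key D' hD']

lemma nu_le_encard_of_isSuppressionOf (h : H'.IsSuppressionOf H) :
    H'.nu ≤ {D | MultiCover H.IsNonloopAt H.edgeSet D}.encard := by
  have key : ∀ K, Relation.ReflTransGen SuppressStep H K →
      {D | MultiCover K.IsNonloopAt K.edgeSet D}.encard ≤
        {D | MultiCover H.IsNonloopAt H.edgeSet D}.encard := by
    intro K hK
    induction hK with
    | refl => exact le_rfl
    | tail _ hs ih => exact (encard_multiCover_le_of_suppressStep hs).trans ih
  exact (nu_le_encard_multiCover H').trans (key H' h.1)

end Graph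

end

/-! ### From minimal even sets back to circuits of a cubic graph -/

section

open scoped Classical

namespace Graph

open CycleSpace

variable {α β : Type*} {G : Graph α β} {x y : α} {g : β} {F : Finset β}

/-- The local structure at a vertex of degree three. -/
lemma deg_three (h : G.deg x = 3) :
    (∃ a b c, a ≠ b ∧ a ≠ c ∧ b ≠ c ∧ (∀ g, G.IsNonloopAt g x ↔ g = a ∨ g = b ∨ g = c) ∧
      ∀ g, ¬ G.IsLoopAt g x) ∨
      ∃ a, ∀ g, G.IsNonloopAt g x ↔ g = a := by
  obtain ⟨h1, h2, h3⟩ := deg_nat (n := 3) h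
  have : (G.loopSet x).ncard = 0 ∨ (G.loopSet x).ncard = 1 := by omega
  rcases this with h0 | h0
  · obtain ⟨a, b, c, hab, hac, hbc, hs⟩ :=
      Set.ncard_eq_three.1 (show {g | G.IsNonloopAt g x}.ncard = 3 by omega)
    rw [Set.ncard_eq_zero h2] at h0
    refine Or.inl ⟨a, b, c, hab, hac, hbc, fun g => ?_, fun g hg => ?_⟩
    · change g ∈ {g | G.IsNonloopAt g x} ↔ _
      rw [hs]; simp
    · have : g ∈ G.loopSet x := hg
      simp [h0] at this
  · obtain ⟨a, ha⟩ := Set.ncard_eq_one.1 (show {g | G.IsNonloopAt g x}.ncard = 1 by omega)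
    refine Or.inr ⟨a, fun g => ?_⟩
    change g ∈ {g | G.IsNonloopAt g x} ↔ _
    rw [ha]; simp

/-- The subgraph formed by a set of edges and their ends. -/
def ofEdges (G : Graph α β) (F : Finset β) : Graph α β where
  vertexSet := {x | ∃ g ∈ F, G.Inc g x}
  IsLink g x y := g ∈ F ∧ G.IsLink g x y
  edgeSet := {g | g ∈ F ∧ g ∈ G.edgeSet}
  isLink_symm _ _ := ⟨fun _ _ h => ⟨h.1, h.2.symm⟩⟩
  eq_or_eq_of_isLink_of_isLink _ _ _ _ _ h h' := h.2.left_eq_or_eq h'.2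
  edge_mem_iff_exists_isLink g := by
    constructor
    · rintro ⟨h1, h2⟩
      obtain ⟨x, y, h⟩ := exists_isLink_of_mem_edgeSet h2
      exact ⟨x, y, h1, h⟩
    · rintro ⟨x, y, h1, h2⟩
      exact ⟨h1, h2.edge_mem⟩
  left_mem_of_isLink g _ _ h := ⟨g, h.1, h.2.inc_left⟩

lemma ofEdges_le (G : Graph α β) (F : Finset β) : G.ofEdges F ≤ G :=
  ⟨fun _ ⟨_, _, h⟩ => h.vertex_mem, fun _ _ _ h => h.2⟩

lemma ofEdges_inc : (G.ofEdges F).Inc g x ↔ g ∈ F ∧ G.Inc g x :=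
  ⟨fun ⟨y, h1, h2⟩ => ⟨h1, y, h2⟩, fun ⟨h1, y, h2⟩ => ⟨y, h1, h2⟩⟩

lemma edgeSet_ofEdges (hF : ↑F ⊆ G.edgeSet) : (G.ofEdges F).edgeSet = ↑F :=
  Set.ext fun _ => ⟨fun h => h.1, fun h => ⟨h, hF h⟩⟩

/-- The edge set of a connected component. -/
lemma isConnected_ofEdges (hF : ↑F ⊆ G.edgeSet) (hc : IsCirc G.IsNonloopAt F) :
    (G.ofEdges F).IsConnected := by
  constructor
  · obtain ⟨g, hg⟩ := hc.1
    obtain ⟨x, y, h⟩ := exists_isLink_of_mem_edgeSet (hF hg)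
    exact ⟨x, g, hg, h.inc_left⟩
  · rintro x ⟨gx, hgx, hx⟩ y ⟨gy, hgy, hy⟩
    have hstep : ∀ g ∈ F, ∀ z w, G.Inc g z → G.Inc g w →
        Relation.ReflTransGen (G.ofEdges F).Adj x z →
          Relation.ReflTransGen (G.ofEdges F).Adj x w := by
      rintro g hg z w ⟨z', hz⟩ hw hr
      rcases hw.eq_or_eq_of_isLink hz with rfl | rfl
      · exact hr
      · exact hr.tail ⟨g, hg, hz⟩
    -- The edges reachable from `x` keep all of `F` at reachable vertices and nothing elsewhere, so
    -- they form an even subset and minimality applies.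
    have key : F.filter (fun g => ∃ z, Relation.ReflTransGen (G.ofEdges F).Adj x z ∧ G.Inc g z) =
        F := by
      refine hc.2.2 _ (Finset.filter_subset _ _)
        ⟨gx, Finset.mem_filter.2 ⟨hgx, x, .refl, hx⟩⟩ fun w => ?_
      by_cases hw : Relation.ReflTransGen (G.ofEdges F).Adj x w
      · rw [← hc.2.1 w]
        simp only [bd, Finset.sum_filter]
        refine Finset.sum_congr rfl fun g _ => ?_
        by_cases hgw : G.IsNonloopAt g w
        · rw [if_pos ⟨w, hw, hgw.inc⟩]
        · simp [hgw]
      · refine Finset.sum_eq_zero fun g hg => if_neg fun hgw => hw ?_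
        obtain ⟨hg, z, hz, hgz⟩ := Finset.mem_filter.1 hg
        exact hstep g hg z w hgz hgw.inc hz
    rw [← key] at hgy
    obtain ⟨hgy, z, hz, hgz⟩ := Finset.mem_filter.1 hgy
    exact hstep gy hgy z y hgz hy hz

lemma isEven_singleton_loop (h : G.IsLoopAt g x) : IsEven G.IsNonloopAt {g} := fun y => by
  rw [bd_singleton, if_neg (h.not_isNonloopAt y)]

/-- A set containing a loop is that loop alone, by minimality. Otherwise evenness at a cubic vertex
leaves exactly two of three edges; a vertex with a single nonloop edge cannot be met, for parity. -/
lemma isCircuit_ofEdges (hfin : G.vertexSet.Finite) (hG : G.IsCubic) (hF : ↑F ⊆ G.edgeSet)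
    (hc : IsCirc G.IsNonloopAt F) : (G.ofEdges F).IsCircuit := by
  refine ⟨hfin.subset (ofEdges_le G F).vertexSet_mono, isConnected_ofEdges hF hc, ?_⟩
  rintro x ⟨gx, hgx, hx⟩
  by_cases hl : ∃ l ∈ F, ∃ z, G.IsLoopAt l z
  · obtain ⟨l, hlF, z, hz⟩ := hl
    obtain rfl := hc.2.2 {l} (by simpa using hlF) ⟨l, by simp⟩ (isEven_singleton_loop hz)
    obtain rfl : gx = l := by simpa using hgx
    obtain rfl := hz.eq_of_inc hx
    have h1 : (G.ofEdges {gx}).incidenceSet z = {gx} := by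
      ext g
      simp only [mem_incidenceSet, ofEdges_inc, Finset.mem_singleton, Set.mem_singleton_iff]
      exact ⟨fun h => h.1, fun h => ⟨h, h ▸ hz.inc⟩⟩
    have h2 : (G.ofEdges {gx}).loopSet z = {gx} := by
      ext g
      simp only [mem_loopSet, Set.mem_singleton_iff]
      exact ⟨fun h => by simpa using h.1, fun h => by subst h; exact ⟨by simp, hz⟩⟩
    rw [deg, h1, h2, Set.encard_singleton, one_add_one_eq_two]
  · push Not at hl
    have hnl : ∀ g ∈ F, (G.Inc g x ↔ G.IsNonloopAt g x) := fun g hg =>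
      ⟨fun h => h.isLoopAt_or_isNonloopAt.resolve_left (hl g hg x), IsNonloopAt.inc⟩
    have h2 : (G.ofEdges F).loopSet x = ∅ :=
      Set.eq_empty_of_forall_notMem fun g hg => hl g hg.1 x hg.2
    have h1 : ∀ g, g ∈ (G.ofEdges F).incidenceSet x ↔ g ∈ F ∧ G.IsNonloopAt g x := fun g => by
      rw [mem_incidenceSet, ofEdges_inc]
      exact and_congr_right fun hg => hnl g hg
    have hgx' := (hnl gx hgx).1 hx
    rcases deg_three (hG x hx.vertex_mem) with ⟨a, b, c, hab, hac, hbc, hs, -⟩ | ⟨a, hs⟩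
    · have hev := (bd_star_eq_zero hab hac hbc hs).1 (hc.2.1 x)
      have key : ∃ p q, p ≠ q ∧ (G.ofEdges F).incidenceSet x = {p, q} := by
        have hs' : ∀ g, g ∈ (G.ofEdges F).incidenceSet x ↔ g ∈ F ∧ (g = a ∨ g = b ∨ g = c) :=
          fun g => by rw [h1, hs]
        rw [hs] at hgx'
        by_cases ha : a ∈ F
        · by_cases hb : b ∈ F
          · refine ⟨a, b, hab, Set.ext fun g => ?_⟩
            simp only [hs', Set.mem_insert_iff, Set.mem_singleton_iff]
            grind
          · refine ⟨a, c, hac, Set.ext fun g => ?_⟩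
            simp only [hs', Set.mem_insert_iff, Set.mem_singleton_iff]
            grind
        · refine ⟨b, c, hbc, Set.ext fun g => ?_⟩
          simp only [hs', Set.mem_insert_iff, Set.mem_singleton_iff]
          grind
      obtain ⟨p, q, hpq, hset⟩ := key
      rw [deg, hset, h2, Set.encard_pair hpq, Set.encard_empty, add_zero]
    · exfalso
      have := hc.2.1 x
      rw [bd, Finset.sum_eq_single a] at this
      · simp [(hs a).2 rfl] at this
      · intro g _ hga
        rw [if_neg]
        exact fun h => hga ((hs g).1 h)
      · intro ha
        exact absurd ((hs gx).1 hgx' ▸ hgx) ha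

/-- Covers with repeated members are not counted on the left, which is harmless for a lower bound on
`nu`. -/
lemma card_covers_le_nu (hfin : G.vertexSet.Finite) (hG : G.IsCubic) {E : Finset β}
    (hE : ↑E = G.edgeSet) : ((covers G.IsNonloopAt E).card : ℕ∞) ≤ G.nu := by
  rw [← Set.encard_coe_eq_coe_finsetCard]
  have hEF : ∀ {D}, D ∈ covers G.IsNonloopAt E → ∀ F ∈ D, ↑F ⊆ G.edgeSet := fun hD F hF => by
    rw [← hE]; exact Finset.coe_subset.2 ((mem_covers.1 hD).1 F hF).1
  have hef : ∀ F : Finset β, ↑F ⊆ G.edgeSet → (G.ofEdges F).edgeFinset = F := fun F hF => by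
    have h := edgeSet_ofEdges hF
    ext g
    rw [mem_edgeFinset (by rw [h]; exact F.finite_toSet), h, Finset.mem_coe]
  refine Set.encard_le_encard_of_injOn
    (f := fun D : Finset (Finset β) => D.val.map G.ofEdges) ?_ ?_
  · intro D hD
    have hD' := mem_covers.1 hD
    refine ⟨fun C hC => ?_, fun g hg => ?_⟩
    · obtain ⟨F, hF, rfl⟩ := Multiset.mem_map.1 hC
      exact ⟨ofEdges_le G F, isCircuit_ofEdges hfin hG (hEF hD F hF) (hD'.1 F hF).2⟩
    · rw [Multiset.countP_map, ← hD'.2 g (by rw [← Finset.mem_coe, hE]; exact hg)]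
      change _ = Multiset.card (D.val.filter _)
      congr 1
      exact Multiset.filter_congr fun F hF => ⟨fun h => h.1, fun h => ⟨h, hg⟩⟩
  · intro D hD D' hD' heq
    have key : ∀ D, D ∈ covers G.IsNonloopAt E → (D.val.map G.ofEdges).map edgeFinset = D.val := by
      intro D hD
      rw [Multiset.map_map]
      conv_rhs => rw [← Multiset.map_id D.val]
      exact Multiset.map_congr rfl fun F hF => hef F (hEF hD F hF)
    apply Finset.val_injective
    rw [← key D hD, ← key D' hD']
    exact congrArg (Multiset.map edgeFinset) heq

end Graph

end

/-! ### Forests and small edge cuts -/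

section

open scoped Classical

namespace CycleSpace

variable {α β : Type*} {I : β → α → Prop} {F F' : Finset β}

lemma exists_isCirc_subset (hne : F.Nonempty) (hF : IsEven I F) : ∃ C ⊆ F, IsCirc I C := by
  induction F using Finset.strongInduction with
  | _ F ih =>
    by_cases hc : IsCirc I F
    · exact ⟨F, subset_rfl, hc⟩
    · have : ∃ F' ⊆ F, F'.Nonempty ∧ IsEven I F' ∧ F' ≠ F := by
        by_contra! h
        exact hc ⟨hne, hF, h⟩
      obtain ⟨F', hsub, hne', hev, hneq⟩ := this
      obtain ⟨C, hC, h⟩ := ih F' (hsub.ssubset_of_ne hneq) hne' hev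
      exact ⟨C, hC.trans hsub, h⟩

lemma bd_symmDiff (x : α) : bd I (symmDiff F F') x = bd I F x + bd I F' x := by
  rw [symmDiff_def, Finset.sup_eq_union, bd_union disjoint_sdiff_sdiff,
    ← Finset.sdiff_inter_self_left F F', bd_sdiff Finset.inter_subset_left,
    ← Finset.sdiff_inter_self_left F' F, bd_sdiff Finset.inter_subset_left,
    Finset.inter_comm F' F]
  have : ∀ a b c : ZMod 2, a + c + (b + c) = a + b := by decide
  exact this _ _ _

/-- A nonempty graph without circuits has fewer edges than vertices. -/
lemma card_lt_of_acyclic {E : Finset β} {Y : Finset α} (hY : Y.Nonempty)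
    (hE : ∀ g ∈ E, HasEnds I g) (hEY : ∀ g ∈ E, ∀ x, I g x → x ∈ Y)
    (hac : ∀ F ⊆ E, F.Nonempty → ¬ IsEven I F) : E.card < Y.card := by
  obtain ⟨y, hy⟩ := hY
  have hzero : ∀ F ⊆ E, ∀ x ∉ Y, bd I F x = 0 := fun F hF x hx =>
    Finset.sum_eq_zero fun g hg => if_neg fun h => hx (hEY g (hF hg) x h)
  -- The map from edge sets to their sets of odd vertices is injective, since a coincidence would
  -- make the symmetric difference even. It misses `{y}`, because an odd vertex never comes alone.
  have h1 : E.powerset.card ≤ (Y.powerset.erase {y}).card := by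
    refine Finset.card_le_card_of_injOn (fun F => Y.filter fun x => bd I F x = 1) ?_ ?_
    · intro F hF
      have hF := Finset.mem_powerset.1 hF
      refine Finset.mem_coe.2 (Finset.mem_erase.2
        ⟨fun h => ?_, Finset.mem_powerset.2 (Finset.filter_subset _ _)⟩)
      beta_reduce at h
      have hy1 : y ∈ Y.filter fun x => bd I F x = 1 := by rw [h]; simp
      obtain ⟨z, hzy, hz, -⟩ := exists_path (fun g hg => hE g (hF hg)) (Finset.mem_filter.1 hy1).2
      have hzY : z ∈ Y := by
        by_contra hc
        rw [hzero F hF z hc] at hz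
        exact zero_ne_one hz
      have : z ∈ Y.filter fun x => bd I F x = 1 := Finset.mem_filter.2 ⟨hzY, hz⟩
      rw [h, Finset.mem_singleton] at this
      exact hzy this
    · intro F hF F' hF' heq
      have hF := Finset.mem_powerset.1 hF
      have hF' := Finset.mem_powerset.1 hF'
      have hsub : symmDiff F F' ⊆ E := by
        intro g hg
        rcases Finset.mem_symmDiff.1 hg with h | h
        exacts [hF h.1, hF' h.1]
      have hev : IsEven I (symmDiff F F') := by
        intro x
        rw [bd_symmDiff]
        by_cases hx : x ∈ Y
        · have := Finset.ext_iff.1 heq x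
          simp only [Finset.mem_filter, hx, true_and] at this
          rcases zmod2_cases (bd I F x) with h | h <;>
            rcases zmod2_cases (bd I F' x) with h' | h' <;> simp [h, h'] at this ⊢
          decide
        · rw [hzero F hF x hx, hzero F' hF' x hx, add_zero]
      by_contra hne
      refine hac _ hsub ?_ hev
      rw [Finset.nonempty_iff_ne_empty]
      exact fun h => hne (symmDiff_eq_bot.1 h)
  rw [Finset.card_erase_of_mem (by simpa using hy), Finset.card_powerset, Finset.card_powerset] at h1
  have h2 : 2 ^ E.card < 2 ^ Y.card := by
    have : 0 < 2 ^ Y.card := by positivity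
    omega
  exact (Nat.pow_lt_pow_iff_right (by norm_num)).1 h2

end CycleSpace

namespace Graph

open CycleSpace

variable {α β : Type*} {G : Graph α β} {x y : α} {g : β}

lemma exists_circuit_induce (hfin : G.vertexSet.Finite) (hG : G.IsCubic) {X : Set α} {F : Finset β}
    (hF : ↑F ⊆ G.edgeSet) (hne : F.Nonempty) (hev : IsEven G.IsNonloopAt F)
    (hX : ∀ g ∈ F, ∀ x, G.Inc g x → x ∈ X) : ∃ C : Graph α β, C ≤ G.induce X ∧ C.IsCircuit := by
  obtain ⟨C, hC, hc⟩ := exists_isCirc_subset hne hev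
  refine ⟨G.ofEdges C, ⟨?_, ?_⟩,
    isCircuit_ofEdges hfin hG ((Finset.coe_subset.2 hC).trans hF) hc⟩
  · rintro x ⟨g, hg, hx⟩
    exact hX g (hC hg) x hx
  · rintro g x y ⟨hg, h⟩
    exact ⟨h, hX g (hC hg) x h.inc_left, hX g (hC hg) y h.inc_right⟩

lemma hasEnds_of_isLink (h : G.IsLink g x y) (hxy : x ≠ y) : HasEnds G.IsNonloopAt g := by
  refine ⟨x, y, hxy, fun z => ⟨fun hz => hz.inc.eq_or_eq_of_isLink h, ?_⟩⟩
  rintro (rfl | rfl)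
  exacts [⟨y, hxy.symm, h⟩, ⟨x, hxy, h.symm⟩]

/-- In a cubic graph, an edge cut with a nonempty acyclic side has at least three edges. -/
lemma three_le_encard_edgeCut (hfin : G.vertexSet.Finite) (hG : G.IsCubic) {X : Set α}
    (hne : (G.vertexSet \ X).Nonempty)
    (hno : ¬ ∃ C : Graph α β, C ≤ G.induce (G.vertexSet \ X) ∧ C.IsCircuit) :
    (3 : ℕ∞) ≤ (G.edgeCut X).encard := by
  have hEfin : G.edgeSet.Finite :=
    finite_edgeSet hfin fun x hx => by rw [hG x hx]; exact ENat.natCast_ne_top 3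
  have hYfin : (G.vertexSet \ X).Finite := hfin.subset Set.sdiff_subset
  set Y := hYfin.toFinset with hYdef
  have hY : ∀ x, x ∈ Y ↔ x ∈ G.vertexSet ∧ x ∉ X := fun x => by simp [hYdef]
  set E := hEfin.toFinset with hEdef
  have hE : ∀ g, g ∈ E ↔ g ∈ G.edgeSet := fun g => by simp [hEdef]
  set EY := E.filter fun g => ∀ x, G.Inc g x → x ∈ Y with hEYdef
  have hcutfin : (G.edgeCut X).Finite := hEfin.subset fun g ⟨x, _, y, _, h⟩ => h.edge_mem
  set K := hcutfin.toFinset with hKdef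
  have hK : ∀ g, g ∈ K ↔ g ∈ G.edgeCut X := fun g => by simp [hKdef]
  have hac : ∀ F ⊆ EY, F.Nonempty → ¬ IsEven G.IsNonloopAt F := by
    intro F hF hne hev
    refine hno (exists_circuit_induce hfin hG (fun g hg => ?_) hne hev fun g hg x hx => ?_)
    · exact (hE g).1 (Finset.mem_filter.1 (hF hg)).1
    · exact (hY x).1 ((Finset.mem_filter.1 (hF hg)).2 x hx)
  have hnoloop : ∀ g ∈ EY, ∀ x, ¬ G.IsLoopAt g x := fun g hg x hx =>
    hac {g} (by simpa using hg) ⟨g, by simp⟩ (isEven_singleton_loop hx)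
  have hends : ∀ g ∈ EY, HasEnds G.IsNonloopAt g := by
    intro g hg
    obtain ⟨x, y, h⟩ := exists_isLink_of_mem_edgeSet ((hE g).1 (Finset.mem_filter.1 hg).1)
    refine hasEnds_of_isLink h ?_
    rintro rfl
    exact hnoloop g hg x h
  have hYne : Y.Nonempty := by
    obtain ⟨y, hy⟩ := hne
    exact ⟨y, (hY y).2 hy⟩
  have hlt : EY.card < Y.card := card_lt_of_acyclic hYne hends
    (fun g hg x hx => (Finset.mem_filter.1 hg).2 x hx.inc) hac
  have hdeg : ∀ x ∈ Y, (E.filter (G.IsNonloopAt · x)).card = 3 := by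
    intro x hx
    obtain ⟨h1, h2, h3⟩ := deg_nat (n := 3) (hG x ((hY x).1 hx).1)
    have hl : G.loopSet x = ∅ := by
      refine Set.eq_empty_of_forall_notMem fun g hg => hnoloop g ?_ x hg
      refine Finset.mem_filter.2 ⟨(hE g).2 (IsLoopAt.edge_mem hg), fun z hz => ?_⟩
      rwa [← IsLoopAt.eq_of_inc hg hz]
    rw [hl, Set.ncard_empty] at h3
    rw [← Set.ncard_coe_finset, ← h3, mul_zero, add_zero]
    congr 1
    ext g
    simp only [Finset.coe_filter, hE, Set.mem_ofPred_eq, and_iff_right_iff_imp]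
    exact fun h => h.edge_mem
  have hcount : ∑ x ∈ Y, (E.filter (G.IsNonloopAt · x)).card =
      ∑ g ∈ E, (Y.filter (G.IsNonloopAt g ·)).card := by
    simp only [Finset.card_filter]
    exact Finset.sum_comm
  have hbound : ∀ g ∈ E, (Y.filter (G.IsNonloopAt g ·)).card ≤
      (if g ∈ EY then 2 else 0) + if g ∈ K then 1 else 0 := by
    intro g hg
    obtain ⟨a, b, hab⟩ := exists_isLink_of_mem_edgeSet ((hE g).1 hg)
    have hsub : Y.filter (G.IsNonloopAt g ·) ⊆ ({a, b} : Finset α) := by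
      intro z hz
      simpa using (Finset.mem_filter.1 hz).2.inc.eq_or_eq_of_isLink hab
    have ha := hY a
    have hb := hY b
    have hav := hab.left_mem
    have hbv := hab.right_mem
    by_cases haY : a ∈ Y <;> by_cases hbY : b ∈ Y
    · have : g ∈ EY := by
        refine Finset.mem_filter.2 ⟨hg, fun x hx => ?_⟩
        rcases hx.eq_or_eq_of_isLink hab with rfl | rfl <;> assumption
      rw [if_pos this]
      exact ((Finset.card_le_card hsub).trans Finset.card_le_two).trans (Nat.le_add_right _ _)
    · have hgK : g ∈ K := (hK g).2 ⟨b, by tauto, a, by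
        refine ⟨hav, ?_⟩; tauto, hab.symm⟩
      have h1 : Y.filter (G.IsNonloopAt g ·) ⊆ ({a} : Finset α) := by
        intro z hz
        rcases Finset.mem_insert.1 (hsub hz) with rfl | h
        · simp
        · rw [Finset.mem_singleton] at h
          exact absurd (h ▸ (Finset.mem_filter.1 hz).1) hbY
      rw [if_pos hgK]
      exact ((Finset.card_le_card h1).trans_eq (Finset.card_singleton a)).trans
        (Nat.le_add_left _ _)
    · have hgK : g ∈ K := (hK g).2 ⟨a, by tauto, b, by
        refine ⟨hbv, ?_⟩; tauto, hab⟩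
      have h1 : Y.filter (G.IsNonloopAt g ·) ⊆ ({b} : Finset α) := by
        intro z hz
        rcases Finset.mem_insert.1 (hsub hz) with rfl | h
        · exact absurd (Finset.mem_filter.1 hz).1 haY
        · exact h
      rw [if_pos hgK]
      exact ((Finset.card_le_card h1).trans_eq (Finset.card_singleton b)).trans
        (Nat.le_add_left _ _)
    · have h1 : Y.filter (G.IsNonloopAt g ·) = ∅ := by
        refine Finset.eq_empty_of_forall_notMem fun z hz => ?_
        have hz' := (Finset.mem_filter.1 hz).1
        rcases Finset.mem_insert.1 (hsub hz) with rfl | h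
        · exact haY hz'
        · rw [Finset.mem_singleton] at h
          exact hbY (h ▸ hz')
      rw [h1, Finset.card_empty]
      exact Nat.zero_le _
  -- Degree sum over `Y`: inner edges count at most twice, cut edges at most once. With `EY.card <
  -- Y.card` the cut has at least `Y.card + 2` edges.
  have htotal : 3 * Y.card ≤ 2 * EY.card + K.card := by
    calc 3 * Y.card = ∑ x ∈ Y, (E.filter (G.IsNonloopAt · x)).card := by
          rw [Finset.sum_congr rfl hdeg, Finset.sum_const, smul_eq_mul, mul_comm]
      _ ≤ ∑ g ∈ E, ((if g ∈ EY then 2 else 0) + if g ∈ K then 1 else 0) := by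
          rw [hcount]; exact Finset.sum_le_sum hbound
      _ = 2 * EY.card + K.card := by
          rw [Finset.sum_add_distrib, ← Finset.sum_filter, ← Finset.sum_filter,
            Finset.sum_const, Finset.sum_const, smul_eq_mul, smul_eq_mul, mul_one, mul_comm]
          have e1 : E.filter (· ∈ EY) = EY := by
            ext g; simp only [Finset.mem_filter, and_iff_right_iff_imp]
            exact fun h => (Finset.mem_filter.1 h).1
          have e2 : E.filter (· ∈ K) = K := by
            ext g; simp only [Finset.mem_filter, and_iff_right_iff_imp]
            intro h
            obtain ⟨x, _, y, _, h⟩ := (hK g).1 h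
            exact (hE g).2 h.edge_mem
          rw [e1, e2]
  have hK3 : 3 ≤ K.card := by
    have := hYne.card_pos
    omega
  rw [hcutfin.encard_eq_coe_toFinset_card]
  exact_mod_cast hK3

end Graph

end

/-! ### The 4-cycle in a cyclically 4-edge-connected cubic graph -/

section

open scoped Classical

namespace Graph

open CycleSpace

variable {α β : Type*} {G : Graph α β} {x y : α} {g : β} {v : Fin 4 → α} {e f : Fin 4 → β}

lemma IsFourCycle.isLink_pred (h : G.IsFourCycle v e) (i : Fin 4) :
    G.IsLink (e (i - 1)) (v (i - 1)) (v i) := by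
  have := h.2 (i - 1)
  rwa [sub_add_cancel] at this

lemma IsFourCycle.ne_succ (h : G.IsFourCycle v e) (i : Fin 4) : v i ≠ v (i + 1) :=
  fun h' => fin4_add_one_ne i (h.1 h').symm

lemma IsFourCycle.injective_edge (h : G.IsFourCycle v e) : Function.Injective e := by
  intro i j hij
  have h1 := h.2 i
  rw [hij] at h1
  rcases h1.eq_and_eq_or_eq_and_eq (h.2 j) with ⟨h1, -⟩ | ⟨h1, h2⟩
  · exact h.1 h1
  · have key : ∀ i j : Fin 4, i = j + 1 → i + 1 = j → i = j := by decide
    exact key i j (h.1 h1) (h.1 h2)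

/-- The third edge at each vertex of the 4-cycle. -/
lemma IsFourCycle.exists_third (h : G.IsFourCycle v e) (hG : G.IsCubic) :
    ∃ f : Fin 4 → β, ∀ i, f i ≠ e i ∧ f i ≠ e (i - 1) ∧
      (∀ g, G.IsNonloopAt g (v i) ↔ g = e i ∨ g = e (i - 1) ∨ g = f i) ∧
      ∀ g, ¬ G.IsLoopAt g (v i) := by
  have key : ∀ i, ∃ f, f ≠ e i ∧ f ≠ e (i - 1) ∧
      (∀ g, G.IsNonloopAt g (v i) ↔ g = e i ∨ g = e (i - 1) ∨ g = f) ∧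
      ∀ g, ¬ G.IsLoopAt g (v i) := by
    intro i
    have h1 : G.IsNonloopAt (e i) (v i) := ⟨_, (h.ne_succ i).symm, h.2 i⟩
    have h2 : G.IsNonloopAt (e (i - 1)) (v i) :=
      ⟨_, fun h' => fin4_sub_one_ne i (h.1 h'), (h.isLink_pred i).symm⟩
    have hne : e i ≠ e (i - 1) := fun h' => fin4_sub_one_ne i (h.injective_edge h').symm
    rcases deg_three (hG (v i) h1.vertex_mem) with ⟨a, b, c, hab, hac, hbc, hs, hl⟩ | ⟨a, hs⟩
    · have h1' := (hs _).1 h1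
      have h2' := (hs _).1 h2
      have : ∃ f, f ≠ e i ∧ f ≠ e (i - 1) ∧
          ∀ g, (g = a ∨ g = b ∨ g = c) ↔ g = e i ∨ g = e (i - 1) ∨ g = f := by
        generalize e i = p at *
        generalize e (i - 1) = q at *
        rcases h1' with rfl | rfl | rfl <;> rcases h2' with rfl | rfl | rfl
        · exact absurd rfl hne
        · exact ⟨c, hac.symm, hbc.symm, fun g => by tauto⟩
        · exact ⟨b, hab.symm, hbc, fun g => by tauto⟩
        · exact ⟨c, hbc.symm, hac.symm, fun g => by tauto⟩
        · exact absurd rfl hne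
        · exact ⟨a, hab, hac, fun g => by tauto⟩
        · exact ⟨b, hbc, hab.symm, fun g => by tauto⟩
        · exact ⟨a, hac, hab, fun g => by tauto⟩
        · exact absurd rfl hne
      obtain ⟨f, hf1, hf2, hf⟩ := this
      exact ⟨f, hf1, hf2, fun g => by rw [hs, hf], hl⟩
    · exact absurd (((hs _).1 h1).trans ((hs _).1 h2).symm) hne
  choose f hf using key
  exact ⟨f, hf⟩

lemma IsFourCycle.isEven (h : G.IsFourCycle v e) :
    IsEven G.IsNonloopAt (Finset.univ.image e) := by
  intro x
  have hi : ∀ i, G.IsNonloopAt (e i) x ↔ x = v i ∨ x = v (i + 1) := by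
    intro i
    refine ⟨fun hx => hx.inc.eq_or_eq_of_isLink (h.2 i), ?_⟩
    rintro (rfl | rfl)
    exacts [⟨_, (h.ne_succ i).symm, h.2 i⟩, ⟨_, h.ne_succ i, (h.2 i).symm⟩]
  rw [bd, Finset.sum_image fun i _ j _ hij => h.injective_edge hij]
  simp only [hi]
  by_cases hx : x ∈ Set.range v
  · obtain ⟨j, rfl⟩ := hx
    simp only [h.1.eq_iff]
    clear hi
    fin_cases j <;> simp <;> decide
  · refine Finset.sum_eq_zero fun i _ => if_neg ?_
    rintro (rfl | rfl) <;> exact hx ⟨_, rfl⟩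

/-- A 4-cycle of a cyclically 4-edge-connected cubic graph other than `K₄` has no chords. -/
lemma IsFourCycle.chordless (h : G.IsFourCycle v e) (hfin : G.vertexSet.Finite) (hG : G.IsCubic)
    (hconn : G.IsCyclicallyEdgeConnected 4) (hK4 : G.vertexSet.ncard ≠ 4)
    (hf : ∀ i, f i ≠ e i ∧ f i ≠ e (i - 1) ∧
      (∀ g, G.IsNonloopAt g (v i) ↔ g = e i ∨ g = e (i - 1) ∨ g = f i) ∧
      ∀ g, ¬ G.IsLoopAt g (v i)) :
    Function.Injective f ∧ ∀ i j, e i ≠ f j := by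
  set X := Set.range v with hXdef
  have hXV : X ⊆ G.vertexSet := by
    rintro _ ⟨i, rfl⟩; exact (h.2 i).left_mem
  -- The 4-cycle is a circuit on one side. A circuit on the other side gives four cut edges;
  -- otherwise that side is acyclic, and nonempty because there are not exactly four vertices.
  have hcut : (3 : ℕ∞) ≤ (G.edgeCut X).encard := by
    by_cases hc : ∃ C : Graph α β, C ≤ G.induce (G.vertexSet \ X) ∧ C.IsCircuit
    · refine le_trans (by norm_num) (hconn X hXV ?_ hc)
      refine exists_circuit_induce hfin hG (F := Finset.univ.image e) ?_ ⟨e 0, by simp⟩ h.isEven ?_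
      · intro g hg
        simp only [Finset.coe_image, Finset.coe_univ, Set.image_univ, Set.mem_range] at hg
        obtain ⟨i, rfl⟩ := hg
        exact (h.2 i).edge_mem
      · intro g hg x hx
        obtain ⟨i, -, rfl⟩ := Finset.mem_image.1 hg
        rcases hx.eq_or_eq_of_isLink (h.2 i) with rfl | rfl <;> exact ⟨_, rfl⟩
    · refine three_le_encard_edgeCut hfin hG ?_ hc
      rw [Set.sdiff_nonempty]
      intro hsub
      refine hK4 ?_
      rw [hsub.antisymm hXV, hXdef, ← Set.image_univ, Set.ncard_image_of_injective _ h.1,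
        Set.ncard_univ, Nat.card_fin]
  have he_cut : ∀ i, e i ∉ G.edgeCut X := by
    rintro i ⟨x, -, y, ⟨-, hy⟩, hxy⟩
    rcases hxy.right_eq_or_eq (h.2 i) with rfl | rfl <;> exact hy ⟨_, rfl⟩
  have hsub : ∀ g ∈ G.edgeCut X, ∃ i, g = f i := by
    rintro g hg
    obtain ⟨x, ⟨i, rfl⟩, y, ⟨-, hy⟩, hxy⟩ := id hg
    have hnl : G.IsNonloopAt g (v i) := ⟨y, fun h' => hy ⟨i, h'.symm⟩, hxy⟩
    rcases ((hf i).2.2.1 g).1 hnl with rfl | rfl | h'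
    exacts [absurd hg (he_cut _), absurd hg (he_cut _), ⟨i, h'⟩]
  -- A third edge staying inside `X` would be shared by two vertices of the 4-cycle, leaving at most
  -- two edges for the cut.
  have hmem : ∀ i, f i ∈ G.edgeCut X := by
    intro i
    by_contra hi
    obtain ⟨w, hw, hlink⟩ := ((hf i).2.2.1 (f i)).2 (Or.inr (Or.inr rfl))
    obtain ⟨j, rfl⟩ : w ∈ X := by
      by_contra hc
      exact hi ⟨v i, ⟨i, rfl⟩, w, ⟨hlink.right_mem, hc⟩, hlink⟩
    have hne : ∀ k, f i ≠ e k := by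
      intro k hk
      have hl := h.2 k
      rw [← hk] at hl
      rcases hlink.left_eq_or_eq hl with h' | h'
      · exact (hf i).1 (by rw [hk, h.1 h'])
      · refine (hf i).2.1 ?_
        rw [hk, h.1 h', add_sub_cancel_right]
    have hji : f i = f j := by
      have hnl : G.IsNonloopAt (f i) (v j) := ⟨v i, hw.symm, hlink.symm⟩
      rcases ((hf j).2.2.1 _).1 hnl with h' | h' | h'
      exacts [absurd h' (hne _), absurd h' (hne _), h']
    have hij : i ≠ j := fun h' => hw (by rw [h'])
    have hs : G.edgeCut X ⊆ ((Finset.univ \ {i, j} : Finset (Fin 4)).image f : Finset β) := by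
      intro g hg
      obtain ⟨k, rfl⟩ := hsub g hg
      refine Finset.mem_coe.2 (Finset.mem_image_of_mem f ?_)
      simp only [Finset.mem_sdiff, Finset.mem_univ, true_and, Finset.mem_insert,
        Finset.mem_singleton, not_or]
      refine ⟨?_, ?_⟩
      · rintro rfl; exact hi hg
      · rintro rfl; exact hi (hji ▸ hg)
    have hle : ((Finset.univ \ {i, j} : Finset (Fin 4)).image f).card ≤ 2 := by
      refine Finset.card_image_le.trans ?_
      rw [Finset.card_sdiff_of_subset (Finset.subset_univ _), Finset.card_pair hij]; rfl
    have h3 := hcut.trans (Set.encard_le_encard hs)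
    rw [Set.encard_coe_eq_coe_finsetCard] at h3
    have : 3 ≤ ((Finset.univ \ {i, j} : Finset (Fin 4)).image f).card := by exact_mod_cast h3
    omega
  refine ⟨fun i j hij => ?_, fun i j hij => he_cut i (hij ▸ hmem j)⟩
  by_contra hne
  obtain ⟨x, -, y, ⟨-, hy⟩, hxy⟩ := hmem i
  have hi : G.Inc (f i) (v i) := (((hf i).2.2.1 (f i)).2 (Or.inr (Or.inr rfl))).inc
  have hj : G.Inc (f i) (v j) := by
    rw [hij]; exact (((hf j).2.2.1 (f j)).2 (Or.inr (Or.inr rfl))).inc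
  have key : ∀ k, G.Inc (f i) (v k) → v k = x := fun k hk =>
    (hk.eq_or_eq_of_isLink hxy).resolve_right fun h' => hy ⟨k, h'⟩
  exact hne (h.1 ((key i hi).trans (key j hj).symm))

lemma deleteEdges_isNonloopAt {S : Set β} (hg : g ∉ S) :
    (G.deleteEdges S).IsNonloopAt g x ↔ G.IsNonloopAt g x := by
  simp only [isNonloopAt_iff_inc_not_isLoopAt, deleteEdges_inc, deleteEdges_isLoopAt, hg,
    not_false_eq_true, and_true]

lemma MultiCover.deleteEdges {S : Set β} {D : Multiset (Finset β)}
    (hD : MultiCover (G.deleteEdges S).IsNonloopAt (G.deleteEdges S).edgeSet D) :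
    MultiCover G.IsNonloopAt (G.edgeSet \ S) D := by
  rw [edgeSet_deleteEdges] at hD
  refine ⟨fun F hF => ⟨(hD.1 F hF).1, ?_⟩, hD.2⟩
  rw [← isCirc_congr fun g hg x => deleteEdges_isNonloopAt ((hD.1 F hF).1 hg).2]
  exact (hD.1 F hF).2

/-- If an edge set containing all edges off the 4-cycle has a circuit double cover, the graph is
loopless. -/
lemma IsFourCycle.square (h : G.IsFourCycle v e) (hG : G.IsCubic) {E : Finset β}
    (hE : ↑E = G.edgeSet) (hf : ∀ i, f i ≠ e i ∧ f i ≠ e (i - 1) ∧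
      (∀ g, G.IsNonloopAt g (v i) ↔ g = e i ∨ g = e (i - 1) ∨ g = f i) ∧
      ∀ g, ¬ G.IsLoopAt g (v i))
    (hinj : Function.Injective f) (hef : ∀ i j, e i ≠ f j) {S : Set β} (hS : ∀ g ∈ S, ∃ i, g = e i)
    {D : Multiset (Finset β)} (hD : MultiCover G.IsNonloopAt (G.edgeSet \ S) D) :
    Square G.IsNonloopAt E v e f := by
  have hout : ∀ x ∉ Set.range v, x ∈ G.vertexSet → ∃ a b c, a ≠ b ∧ a ≠ c ∧ b ≠ c ∧
      (∀ g, G.IsNonloopAt g x ↔ g = a ∨ g = b ∨ g = c) ∧ ∀ g, ¬ G.IsLoopAt g x := by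
    intro x hx hxV
    -- A vertex with a loop has only one nonloop edge. That edge is off the 4-cycle, hence covered,
    -- but any member containing it would be odd at `x`.
    refine (deg_three (hG x hxV)).resolve_right ?_
    rintro ⟨a, ha⟩
    have hax : G.IsNonloopAt a x := (ha a).2 rfl
    have haS : a ∉ S := by
      intro haS
      obtain ⟨i, rfl⟩ := hS a haS
      rcases hax.inc.eq_or_eq_of_isLink (h.2 i) with rfl | rfl <;> exact hx ⟨_, rfl⟩
    have hcount := hD.2 a ⟨hax.edge_mem, haS⟩
    obtain ⟨F, hF, haF⟩ := Multiset.countP_pos.1 (by rw [hcount]; norm_num : 0 < D.countP (a ∈ ·))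
    have hev := (hD.1 F hF).2.2.1 x
    rw [bd, Finset.sum_eq_single a] at hev
    · simp [hax] at hev
    · intro g _ hga
      exact if_neg fun hg => hga ((ha g).1 hg)
    · exact fun h' => absurd haF h'
  have hnoloop : ∀ g x, ¬ G.IsLoopAt g x := by
    intro g x hg
    by_cases hx : x ∈ Set.range v
    · obtain ⟨i, rfl⟩ := hx
      exact (hf i).2.2.2 g hg
    · obtain ⟨_, _, _, _, _, _, _, hl⟩ := hout x hx hg.vertex_mem
      exact hl g hg
  refine ⟨h.1, h.injective_edge, hinj, hef, fun i => (hf i).2.2.1, fun x hx => ?_, fun g hg => ?_,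
    fun g x hg => ?_⟩
  · by_cases hxV : x ∈ G.vertexSet
    · obtain ⟨a, b, c, h1, h2, h3, h4, -⟩ := hout x hx hxV
      exact Or.inr ⟨a, b, c, h1, h2, h3, h4⟩
    · exact Or.inl fun g hg => hxV hg.vertex_mem
  · rw [← Finset.mem_coe, hE] at hg
    obtain ⟨x, y, hxy⟩ := exists_isLink_of_mem_edgeSet hg
    refine hasEnds_of_isLink hxy ?_
    rintro rfl
    exact hnoloop g x hxy
  · rw [← Finset.mem_coe, hE]; exact hg.edge_mem

end Graph

namespace CycleSpace

variable {α β : Type*} {I : β → α → Prop} {E : Finset β} {v : Fin 4 → α} {e f : Fin 4 → β}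

/-- Every member leaves the 4-cycle, so `count_le_one` rules out repetitions and multisets may be
replaced by finite sets. -/
lemma Square.encard_multiCover_le (h : Square I E v e f) (r : Fin 4) :
    {D | MultiCover I (↑E \ {e (r + 1), e (r + 3)}) D}.encard ≤
      (covers I (E \ {e (r + 1), e (r + 3)})).card := by
  rw [← Set.encard_coe_eq_coe_finsetCard]
  have hE : (↑E \ {e (r + 1), e (r + 3)} : Set β) = ↑(E \ {e (r + 1), e (r + 3)}) := by simp
  rw [hE]
  have hnodup : ∀ D, MultiCover I ↑(E \ {e (r + 1), e (r + 3)}) D → D.Nodup := by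
    intro D hD
    rw [Multiset.nodup_iff_count_le_one]
    intro F
    by_cases hF : F ∈ D
    · obtain ⟨hFE, hc⟩ := hD.1 F hF
      rw [Finset.coe_subset] at hFE
      obtain ⟨g, hg, hge⟩ := h.exists_off_cycle (r := r) hc.2.1 hc.1
        (fun h' => by simpa using hFE h') (fun h' => by simpa using hFE h')
      refine le_trans ?_ (h.count_le_one (outer_sdiff (r + 1) (r + 3))
        (fun C hC => (hD.1 C hC).2.2.1) (fun k hk => hD.2 k (Finset.mem_coe.2 hk)) hg
        (Finset.sdiff_subset (hFE hg)) hge fun x _ => hc.2.1 x)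
      rw [Multiset.count, Multiset.countP_eq_card_filter, Multiset.countP_eq_card_filter]
      exact Multiset.card_le_card (Multiset.monotone_filter_right _ fun C hC => hC ▸ subset_rfl)
    · rw [Multiset.count_eq_zero_of_notMem hF]; norm_num
  refine Set.encard_le_encard_of_injOn (f := Multiset.toFinset) ?_ ?_
  · intro D hD
    have hval : D.toFinset.val = D := by
      rw [Multiset.toFinset_val, Multiset.dedup_eq_self.2 (hnodup D hD)]
    refine Finset.mem_coe.2 (mem_covers.2 ⟨fun F hF => ?_, fun g hg => ?_⟩)
    · have := hD.1 F (Multiset.mem_toFinset.1 hF)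
      exact ⟨Finset.coe_subset.1 this.1, this.2⟩
    · rw [← hD.2 g (Finset.mem_coe.2 hg), Multiset.countP_eq_card_filter]
      change Multiset.card (Multiset.filter _ D.toFinset.val) = _
      rw [hval]
  · intro D hD D' hD' heq
    have key : ∀ D, MultiCover I ↑(E \ {e (r + 1), e (r + 3)}) D → D.toFinset.val = D :=
      fun D hD => by rw [Multiset.toFinset_val, Multiset.dedup_eq_self.2 (hnodup D hD)]
    rw [← key D hD, heq, key D' hD']

end CycleSpace

end

/-! ### Assembling the inequality -/

open Graph CycleSpace
open scoped Finset
theorem theorem6p2 {α β : Type*} (G G₁ G₂ : Graph α β)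
    (hfin : G.vertexSet.Finite) (hcubic : G.IsCubic)
    (hconn : G.IsCyclicallyEdgeConnected 4)
    -- the only graph excluded here is the complete graph on four vertices
    (hK4 : G.vertexSet.ncard ≠ 4)
    (v : Fin 4 → α) (e : Fin 4 → β) (hcycle : G.IsFourCycle v e)
    (h₁ : G₁.IsSuppressionOf (G.deleteEdges {e 0, e 2}))
    (h₂ : G₂.IsSuppressionOf (G.deleteEdges {e 1, e 3})) :
    4 * min G₁.nu G₂.nu ≤ G.nu := by
  classical
  have hEfin : G.edgeSet.Finite :=
    finite_edgeSet hfin fun x hx => by rw [hcubic x hx]; exact ENat.natCast_ne_top 3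
  have hE : ↑hEfin.toFinset = G.edgeSet := by simp
  obtain ⟨f, hf⟩ := hcycle.exists_third hcubic
  obtain ⟨hinj, hef⟩ := hcycle.chordless hfin hcubic hconn hK4 hf
  have hle : ∀ {K : Graph α β} {S : Set β}, K.IsSuppressionOf (G.deleteEdges S) →
      K.nu ≤ {D | MultiCover G.IsNonloopAt (G.edgeSet \ S) D}.encard := fun hK =>
    (nu_le_encard_of_isSuppressionOf hK).trans
      (Set.encard_le_encard fun D hD => MultiCover.deleteEdges hD)
  have hle₁ := hle h₁
  have hle₂ := hle h₂
  -- A cover is needed to exclude loops in `G`. If there is none, `G₁.nu = 0` and the left side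
  -- vanishes.
  by_cases hne : ∃ D, MultiCover G.IsNonloopAt (G.edgeSet \ {e 0, e 2}) D
  · obtain ⟨D, hD⟩ := hne
    have hsq := hcycle.square hcubic hE hf hinj hef (S := {e 0, e 2}) (by
      rintro g (rfl | rfl)
      exacts [⟨0, rfl⟩, ⟨2, rfl⟩]) hD
    have b₁ := hsq.encard_multiCover_le 1
    have b₂ := hsq.encard_multiCover_le 0
    have u₁ : G₁.nu ≤ (#(covers G.IsNonloopAt (hEfin.toFinset \ {e 0, e 2})) : ℕ∞) := by
      rw [Set.pair_comm] at hle₁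
      rw [Finset.pair_comm]
      rw [hE] at b₁
      exact hle₁.trans b₁
    have u₂ : G₂.nu ≤ (#(covers G.IsNonloopAt (hEfin.toFinset \ {e 1, e 3})) : ℕ∞) := by
      rw [hE] at b₂
      exact hle₂.trans b₂
    have hc : (2 * #(covers G.IsNonloopAt (hEfin.toFinset \ {e 0, e 2})) +
        2 * #(covers G.IsNonloopAt (hEfin.toFinset \ {e 1, e 3})) : ℕ∞) ≤
        #(covers G.IsNonloopAt hEfin.toFinset) := by
      exact_mod_cast hsq.card_covers_le
    calc 4 * min G₁.nu G₂.nu = 2 * min G₁.nu G₂.nu + 2 * min G₁.nu G₂.nu := by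
          rw [← add_mul]; norm_num
      _ ≤ _ := by
          gcongr
          exacts [(min_le_left _ _).trans u₁, (min_le_right _ _).trans u₂]
      _ ≤ _ := hc
      _ ≤ G.nu := card_covers_le_nu hfin hcubic hE
  · have h0 : G₁.nu = 0 := by
      rw [← nonpos_iff_eq_zero]
      refine hle₁.trans (le_of_eq (Set.encard_eq_zero.2 (Set.eq_empty_of_forall_notMem ?_)))
      exact fun D hD => hne ⟨D, hD⟩
    rw [h0, min_eq_left zero_le, mul_zero]
    exact zero_le
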